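/- Throughout, $k$ is a commutative ring, all algebras are unital associative $k$-algebras, all modules are $k$-modules and all maps are $k$-linear. **Hopf algebroids.** A *left bialgebroid* $\mathcal H_L=(H,L,s_L,t_L,\gamma_L,\pi_L)$ consists of algebras $L$ and $H$, an algebra map $s_L:L\to H$ and an anti-algebra map $t_L:L\to H$ with commuting images, and an $L$-coring structure, with coproduct $\gamma_L(h)=h_{(1)}\otimes_L h_{(2)}$ and counit $\pi_L$, on the bimodule $H$ with $l\cdot h\cdot l'=s_L(l)t_L(l')h$, such that $h_{(1)}t_L(l)\otimes_L h_{(2)}=h_{(1)}\otimes_L h_{(2)}s_L(l)$, $\gamma_L$ is unital and multiplicative, $\pi_L(1)=1$ and $\pi_L(h\,s_L(\pi_L(h')))=\pi_L(hh')=\pi_L(h\,t_L(\pi_L(h')))$. A *right bialgebroid* $\mathcal H_R=(H,R,s_R,t_R,\gamma_R,\pi_R)$, with $\gamma_R(h)=h^{(1)}\otimes_R h^{(2)}$, is defined symmetrically, using the bimodule structure $r\cdot h\cdot r'=h\,s_R(r')t_R(r)$. A *Hopf algebroid* $\mathcal H=(\mathcal H_L,\mathcal H_R,S)$ consists of a left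 and a right bialgebroid on the same algebra $H$ and a $k$-linear map $S:H\to H$ (the antipode, not assumed to be bijective) such that - $s_L\pi_Lt_R=t_R$, $t_L\pi_Ls_R=s_R$, $s_R\pi_Rt_L=t_L$, $t_R\pi_Rs_L=s_L$; - $\gamma_L$ is $R$-bilinear and $\gamma_R$ is $L$-bilinear (with respect to the actions $r\cdot h\cdot r'$ and $l\cdot h\cdot l'$ above, the left actions being on the first and the right actions on the second tensor factor), $(\gamma_L\otimes_R H)\gamma_R=(H\otimes_L\gamma_R)\gamma_L$ and $(\gamma_R\otimes_L H)\gamma_L=(H\otimes_R\gamma_L)\gamma_R$; - $S(t_L(l)\,h\,t_R(r))=s_R(r)S(h)s_L(l)$; - $S(h_{(1)})h_{(2)}=s_R(\pi_R(h))$ and $h^{(1)}S(h^{(2)})=s_L(\pi_L(h))$. No purity condition is imposed. **Comodules.** A (right) $\mathcal H$-*comodule* is a right $R$- and right $L$-module $M$ with a coaction $m\mapsto m^{[0]}\otimes_R m^{[1]}$ of the $R$-coring $\mathcal H_R$ and a coaction $m\mapsto m_{[0]}\otimes_L m_{[1]}$ of the $L$-coring $\mathcal H_L$, such that the $\mathcal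 H_R$-coaction is an $\mathcal H_L$-comodule map and the $\mathcal H_L$-coaction is an $\mathcal H_R$-comodule map. A morphism of $\mathcal H$-comodules is a right $R$- and right $L$-linear map commuting with both coactions. $\mathcal H$-comodules form a monoidal category $\mathcal M^{\mathcal H}$: the tensor product is $\otimes_R$, the left $R$-action on a comodule being $r\,m=m\,\pi_L(s_R(r))$, with the diagonal coactions $m\otimes n\mapsto (m^{[0]}\otimes_R n^{[0]})\otimes_R m^{[1]}n^{[1]}$ and $m\otimes n\mapsto (m_{[0]}\otimes_R n_{[0]})\otimes_L m_{[1]}n_{[1]}$. An $\mathcal H$-*comodule algebra* $A$ is a monoid in $\mathcal M^{\mathcal H}$; in particular it is an $R$-ring with unit map $\eta_R:R\to A$. Let $\mathcal M^{\mathcal H}_A$ be the category of right $A$-modules in $\mathcal M^{\mathcal H}$. The algebra $H$, with coactions $\gamma_R$ and $\gamma_L$, is an $\mathcal H$-comodule algebra. The *coinvariants* of $A$ form the subalgebra $T=\{a\in A\mid a^{[0]}\otimes_R a^{[1]}=a\otimes_R 1_H\}$. **Cleft extensions.** $T\subseteq A$ is $\mathcal H$-*cleft* if there are an algebra map $\eta_L:L\to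 A$ with image in $T$ (so that $A$ is an $L$-ring and $T$ an $L$-subring), a left $L$-linear morphism of $\mathcal H$-comodules $j:H\to A$ (that is, $j(s_L(l)h)=\eta_L(l)j(h)$), and a map $\widetilde j:H\to A$ with $\widetilde j(h\,t_R(r))=\eta_R(r)\widetilde j(h)$ and $\widetilde j(t_L(l)h)=\widetilde j(h)\eta_L(l)$, such that for all $h\in H$ $$j(h^{(1)})\,\widetilde j(h^{(2)})=\eta_L(\pi_L(h)),\qquad \widetilde j(h_{(1)})\,j(h_{(2)})=\eta_R(\pi_R(h)).$$ **Theorem.** Let $\mathcal H$ be any (not necessarily pure) Hopf algebroid. 1. For every $\mathcal H$-comodule algebra $A$ such that $T\subseteq A$ is $\mathcal H$-cleft, where $T$ is the subalgebra of coinvariants, the functor $-\otimes_T A:\mathcal M_T\to\mathcal M^{\mathcal H}_A$ (with the $A$-action and the $\mathcal H$-coactions on the second factor) is an equivalence of categories. 2. The functor $-\otimes_L H:\mathcal M_L\to\mathcal M^{\mathcal H}_H$, where $H$ is a left $L$-module via $s_L$, is an equivalence of categories. -/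

import Mathlib

open TensorProduct MulOpposite CategoryTheory

universe v u₁ u₂ u₃ u₄ u₅

namespace HopfAlgd

/-! ### Modules over noncommutative algebras and balanced tensor products

All modules carry a fixed `k`-module structure. A `k`-module may carry several actions of the same
algebra, so that actions are explicit homomorphisms to the endomorphism algebra. -/

/-- A left module structure of the `k`-algebra `B` on the `k`-module `M`. -/
abbrev LAct (k B M : Type*) [CommRing k] [Ring B] [Algebra k B] [AddCommGroup M] [Module k M] :=
  B →ₐ[k] Module.End k M

/-- A right module structure of the `k`-algebra `B` on the `k`-module `M`. -/
abbrev RAct (k B M : Type*) [CommRing k] [Ring B] [Algebra k B] [AddCommGroup M] [Module k M] :=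
  Bᵐᵒᵖ →ₐ[k] Module.End k M

section BT

variable {k : Type*} [CommRing k] {B : Type*} [Ring B] [Algebra k B]
  {C : Type*} [Ring C] [Algebra k C]
  {M : Type*} [AddCommGroup M] [Module k M] {N : Type*} [AddCommGroup N] [Module k N]
  {M' : Type*} [AddCommGroup M'] [Module k M'] {N' : Type*} [AddCommGroup N'] [Module k N']
  {P : Type*} [AddCommGroup P] [Module k P]
  {X : Type*} [AddCommGroup X] [Module k X] {Y : Type*} [AddCommGroup Y] [Module k Y]

/-- The relations `m b ⊗ n = m ⊗ b n`. -/
def balRel (ρ : RAct k B M) (σ : LAct k B N) : Submodule k (M ⊗[k] N) :=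
  Submodule.span k {x | ∃ (b : B) (m : M) (n : N), x = ρ (op b) m ⊗ₜ n - m ⊗ₜ σ b n}

/-- The tensor product `M ⊗_B N` of a right and a left `B`-module. -/
def BT (ρ : RAct k B M) (σ : LAct k B N) : Type _ := (M ⊗[k] N) ⧸ balRel ρ σ

variable {ρ : RAct k B M} {σ : LAct k B N} {ρ' : RAct k B M'} {σ' : LAct k B N'}

instance BT.addCommGroup : AddCommGroup (BT ρ σ) :=
  inferInstanceAs (AddCommGroup ((M ⊗[k] N) ⧸ balRel ρ σ))

instance BT.module : Module k (BT ρ σ) :=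
  inferInstanceAs (Module k ((M ⊗[k] N) ⧸ balRel ρ σ))

/-- `m ⊗_B n`, as a bilinear map. -/
def BT.mk (ρ : RAct k B M) (σ : LAct k B N) : M →ₗ[k] N →ₗ[k] BT ρ σ :=
  (TensorProduct.mk k M N).compr₂ (balRel ρ σ).mkQ

theorem BT.mk_bal (b : B) (m : M) (n : N) :
    BT.mk ρ σ (ρ (op b) m) n = BT.mk ρ σ m (σ b n) :=
  (Submodule.Quotient.eq (balRel ρ σ)).2 (Submodule.subset_span ⟨b, m, n, rfl⟩)

/-- The linear map on `M ⊗_B N` given by a balanced bilinear map. -/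
def BT.lift (φ : M →ₗ[k] N →ₗ[k] P) (h : ∀ (b : B) m n, φ (ρ (op b) m) n = φ m (σ b n)) :
    BT ρ σ →ₗ[k] P :=
  (balRel ρ σ).liftQ (TensorProduct.lift φ) (by
    refine Submodule.span_le.2 ?_
    rintro _ ⟨b, m, n, rfl⟩
    simp [h])

@[simp] theorem BT.lift_mk (φ : M →ₗ[k] N →ₗ[k] P)
    (h : ∀ (b : B) m n, φ (ρ (op b) m) n = φ m (σ b n)) (m : M) (n : N) :
    BT.lift φ h (BT.mk ρ σ m n) = φ m n :=
  TensorProduct.lift.tmul m n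

theorem BT.induction {p : BT ρ σ → Prop} (z : BT ρ σ) (hm : ∀ m n, p (BT.mk ρ σ m n))
    (h0 : p 0) (ha : ∀ x y, p x → p y → p (x + y)) : p z := by
  obtain ⟨t, rfl⟩ := (balRel ρ σ).mkQ_surjective z
  induction t using TensorProduct.induction_on with
  | zero => exact h0
  | tmul m n => exact hm m n
  | add x y hx hy => exact ha _ _ hx hy

theorem BT.hom_ext {f g : BT ρ σ →ₗ[k] P} (h : ∀ m n, f (BT.mk ρ σ m n) = g (BT.mk ρ σ m n)) :
    f = g := by
  ext z
  induction z using BT.induction with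
  | hm m n => exact h m n
  | h0 => simp
  | ha x y hx hy => simp [hx, hy]

/-- `f ⊗_B g` for a map `f` of right and a map `g` of left `B`-modules. -/
def BT.map (f : M →ₗ[k] M') (g : N →ₗ[k] N') (hf : ∀ (b : Bᵐᵒᵖ) m, f (ρ b m) = ρ' b (f m))
    (hg : ∀ b n, g (σ b n) = σ' b (g n)) : BT ρ σ →ₗ[k] BT ρ' σ' :=
  BT.lift ((BT.mk ρ' σ').compl₁₂ f g) (fun b m n => by simp [hf, hg, BT.mk_bal])

@[simp] theorem BT.map_mk (f : M →ₗ[k] M') (g : N →ₗ[k] N')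
    (hf : ∀ (b : Bᵐᵒᵖ) m, f (ρ b m) = ρ' b (f m))
    (hg : ∀ b n, g (σ b n) = σ' b (g n)) (m : M) (n : N) :
    BT.map f g hf hg (BT.mk ρ σ m n) = BT.mk ρ' σ' (f m) (g n) := by
  simp [BT.map]

/-- For bilinear maps `F : X × M → M'` and `G : Y × N → N'` which are `B`-linear in the second
variable, the map `m ⊗_B n ↦ (x, y) ↦ F(x, m) ⊗_B G(y, n)`. -/
def BT.bimap (F : X →ₗ[k] M →ₗ[k] M') (G : Y →ₗ[k] N →ₗ[k] N')
    (hF : ∀ x (b : Bᵐᵒᵖ) m, F x (ρ b m) = ρ' b (F x m))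
    (hG : ∀ y b n, G y (σ b n) = σ' b (G y n)) : BT ρ σ →ₗ[k] X →ₗ[k] Y →ₗ[k] BT ρ' σ' :=
  BT.lift
    (LinearMap.mk₂ k (fun m n => (BT.mk ρ' σ').compl₁₂ (F.flip m) (G.flip n))
      (fun _ _ _ => by ext; simp) (fun _ _ _ => by ext; simp)
      (fun _ _ _ => by ext; simp) (fun _ _ _ => by ext; simp))
    (fun b m n => by ext; simp [hF, hG, BT.mk_bal])

@[simp] theorem BT.bimap_mk (F : X →ₗ[k] M →ₗ[k] M') (G : Y →ₗ[k] N →ₗ[k] N')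
    (hF : ∀ x (b : Bᵐᵒᵖ) m, F x (ρ b m) = ρ' b (F x m))
    (hG : ∀ y b n, G y (σ b n) = σ' b (G y n)) (m : M) (n : N) (x : X) (y : Y) :
    BT.bimap F G hF hG (BT.mk ρ σ m n) x y = BT.mk ρ' σ' (F x m) (G y n) := by
  simp [BT.bimap]

theorem BT.bimap_apply (F : X →ₗ[k] M →ₗ[k] M') (G : Y →ₗ[k] N →ₗ[k] N')
    (hF : ∀ x (b : Bᵐᵒᵖ) m, F x (ρ b m) = ρ' b (F x m))
    (hG : ∀ y b n, G y (σ b n) = σ' b (G y n)) (z : BT ρ σ) (x : X) (y : Y) :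
    BT.bimap F G hF hG z x y = BT.map (F x) (G y) (hF x) (hG y) z := by
  induction z using BT.induction with
  | hm m n => simp
  | h0 => simp
  | ha a b ha hb => simp [ha, hb]

theorem BT.bimap_bal (F : X →ₗ[k] M →ₗ[k] M') (G : Y →ₗ[k] N →ₗ[k] N')
    (hF : ∀ x (b : Bᵐᵒᵖ) m, F x (ρ b m) = ρ' b (F x m))
    (hG : ∀ y b n, G y (σ b n) = σ' b (G y n)) {z : BT ρ σ} {f : M →ₗ[k] M} {g : N →ₗ[k] N}
    {hf : ∀ (b : Bᵐᵒᵖ) m, f (ρ b m) = ρ b (f m)} {hg : ∀ b n, g (σ b n) = σ b (g n)}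
    (hz : BT.map (ρ' := ρ) (σ' := σ) f LinearMap.id hf (fun _ _ => rfl) z =
      BT.map LinearMap.id g (fun _ _ => rfl) hg z)
    {x x' : X} {y y' : Y} (hx : ∀ m, F x' m = F x (f m)) (hy : ∀ n, G y' n = G y (g n)) :
    BT.bimap F G hF hG z x' y = BT.bimap F G hF hG z x y' := by
  have h1 : ∀ w : BT ρ σ, BT.bimap F G hF hG w x' y = BT.bimap F G hF hG
      (BT.map (ρ' := ρ) (σ' := σ) f LinearMap.id hf (fun _ _ => rfl) w) x y := fun w => by
    induction w using BT.induction with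
    | hm m n => simp [hx]
    | h0 => simp
    | ha a b ha hb => simp [ha, hb]
  have h2 : ∀ w : BT ρ σ, BT.bimap F G hF hG w x y' = BT.bimap F G hF hG
      (BT.map (ρ' := ρ) (σ' := σ) LinearMap.id g (fun _ _ => rfl) hg w) x y := fun w => by
    induction w using BT.induction with
    | hm m n => simp [hy]
    | h0 => simp
    | ha a b ha hb => simp [ha, hb]
  rw [h1, h2, hz]

/-- `m ⊗_B n ↦ x ↦ F(x, m) ⊗_B n`. -/
def BT.mapL (F : X →ₗ[k] M →ₗ[k] M') (hF : ∀ x (b : Bᵐᵒᵖ) m, F x (ρ b m) = ρ' b (F x m)) :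
    BT ρ σ →ₗ[k] X →ₗ[k] BT ρ' σ :=
  LinearMap.applyₗ (1 : k) ∘ₗ LinearMap.lflip.toLinearMap ∘ₗ
    BT.bimap F (LinearMap.lsmul k N) hF (fun _ _ _ => by simp)

@[simp] theorem BT.mapL_apply (F : X →ₗ[k] M →ₗ[k] M')
    (hF : ∀ x (b : Bᵐᵒᵖ) m, F x (ρ b m) = ρ' b (F x m)) (z : BT ρ σ) (x : X) :
    BT.mapL F hF z x = BT.map (F x) LinearMap.id (hF x) (fun _ _ => rfl) z := by
  induction z using BT.induction with
  | hm m n =>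
    exact (BT.bimap_mk (σ := σ) (σ' := σ) F (LinearMap.lsmul k N) hF (fun _ _ _ => by simp) m n x 1).trans (by simp)
  | h0 => simp
  | ha a b ha hb => simp [ha, hb]

/-- `m ⊗_B n ↦ y ↦ m ⊗_B G(y, n)`. -/
def BT.mapR (G : Y →ₗ[k] N →ₗ[k] N') (hG : ∀ y b n, G y (σ b n) = σ' b (G y n)) :
    BT ρ σ →ₗ[k] Y →ₗ[k] BT ρ σ' :=
  LinearMap.applyₗ (1 : k) ∘ₗ BT.bimap (LinearMap.lsmul k M) G (fun _ _ _ => by simp) hG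

@[simp] theorem BT.mapR_apply (G : Y →ₗ[k] N →ₗ[k] N')
    (hG : ∀ y b n, G y (σ b n) = σ' b (G y n)) (z : BT ρ σ) (y : Y) :
    BT.mapR G hG z y = BT.map LinearMap.id (G y) (fun _ _ => rfl) (hG y) z := by
  induction z using BT.induction with
  | hm m n =>
    exact (BT.bimap_mk (ρ := ρ) (ρ' := ρ) (LinearMap.lsmul k M) G (fun _ _ _ => by simp) hG m n 1 y).trans (by simp)
  | h0 => simp
  | ha a b ha hb => simp [ha, hb]

/-- The right `C`-action on `M ⊗_B N` given by a commuting right `C`-action on `N`. -/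
def BT.rightAct (ρ : RAct k B M) (σ : LAct k B N) (τ : RAct k C N)
    (h : ∀ b (c : Cᵐᵒᵖ) n, σ b (τ c n) = τ c (σ b n)) : RAct k C (BT ρ σ) :=
  AlgHom.ofLinearMap
    { toFun := fun c => BT.map (ρ := ρ) (σ := σ) (ρ' := ρ) (σ' := σ) LinearMap.id (τ c)
        (fun _ _ => rfl) (fun b n => (h b c n).symm)
      map_add' := fun _ _ => BT.hom_ext fun _ _ => by simp
      map_smul' := fun _ _ => BT.hom_ext fun _ _ => by simp }
    (BT.hom_ext fun _ _ => by simp) (fun _ _ => BT.hom_ext fun _ _ => by simp)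

@[simp] theorem BT.rightAct_mk (τ : RAct k C N)
    (h : ∀ b (c : Cᵐᵒᵖ) n, σ b (τ c n) = τ c (σ b n)) (c : Cᵐᵒᵖ) (m : M) (n : N) :
    BT.rightAct ρ σ τ h c (BT.mk ρ σ m n) = BT.mk ρ σ m (τ c n) := by
  simp [BT.rightAct]

/-- The left `C`-action on `M ⊗_B N` given by a commuting left `C`-action on `M`. -/
def BT.leftAct (ρ : RAct k B M) (σ : LAct k B N) (τ : LAct k C M)
    (h : ∀ c (b : Bᵐᵒᵖ) m, τ c (ρ b m) = ρ b (τ c m)) : LAct k C (BT ρ σ) :=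
  AlgHom.ofLinearMap
    { toFun := fun c => BT.map (ρ := ρ) (σ := σ) (ρ' := ρ) (σ' := σ) (τ c) LinearMap.id
        (fun b n => h c b n) (fun _ _ => rfl)
      map_add' := fun _ _ => BT.hom_ext fun _ _ => by simp
      map_smul' := fun _ _ => BT.hom_ext fun _ _ => by simp }
    (BT.hom_ext fun _ _ => by simp) (fun _ _ => BT.hom_ext fun _ _ => by simp)

@[simp] theorem BT.leftAct_mk (τ : LAct k C M)
    (h : ∀ c (b : Bᵐᵒᵖ) m, τ c (ρ b m) = ρ b (τ c m)) (c : C) (m : M) (n : N) :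
    BT.leftAct ρ σ τ h c (BT.mk ρ σ m n) = BT.mk ρ σ (τ c m) n := by
  simp [BT.leftAct]

/-- `m ⊗_B n ↦ p ↦ m ⊗_B (n ⊗_C p)`. -/
def BT.insert (ρ : RAct k B M) (σ : LAct k B N) (τ : RAct k C N) (π : LAct k C P)
    (h : ∀ b (c : Cᵐᵒᵖ) n, σ b (τ c n) = τ c (σ b n)) :
    BT ρ σ →ₗ[k] P →ₗ[k] BT ρ (BT.leftAct τ π σ h) :=
  BT.lift
    (LinearMap.mk₂ k (fun m n => (BT.mk ρ (BT.leftAct τ π σ h) m) ∘ₗ BT.mk τ π n)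
      (fun _ _ _ => by ext; simp) (fun _ _ _ => by ext; simp)
      (fun _ _ _ => by ext; simp) (fun _ _ _ => by ext; simp))
    (fun b m n => by ext p; simp [BT.mk_bal])

@[simp] theorem BT.insert_mk (τ : RAct k C N) (π : LAct k C P)
    (h : ∀ b (c : Cᵐᵒᵖ) n, σ b (τ c n) = τ c (σ b n)) (m : M) (n : N) (p : P) :
    BT.insert ρ σ τ π h (BT.mk ρ σ m n) p = BT.mk ρ _ m (BT.mk τ π n p) := by
  simp [BT.insert]

/-- The canonical isomorphism `(M ⊗_B N) ⊗_C P → M ⊗_B (N ⊗_C P)`, `(m ⊗ n) ⊗ p ↦ m ⊗ (n ⊗ p)`. -/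
def BT.assoc (ρ : RAct k B M) (σ : LAct k B N) (τ : RAct k C N) (π : LAct k C P)
    (h : ∀ b (c : Cᵐᵒᵖ) n, σ b (τ c n) = τ c (σ b n)) :
    BT (BT.rightAct ρ σ τ h) π →ₗ[k] BT ρ (BT.leftAct τ π σ h) :=
  BT.lift (BT.insert ρ σ τ π h) (fun c z p => by
    induction z using BT.induction with
    | hm m n => simp [BT.mk_bal]
    | h0 => simp
    | ha x y hx hy => simp [hx, hy])

@[simp] theorem BT.assoc_mk (τ : RAct k C N) (π : LAct k C P)
    (h : ∀ b (c : Cᵐᵒᵖ) n, σ b (τ c n) = τ c (σ b n)) (z : BT ρ σ) (p : P) :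
    BT.assoc ρ σ τ π h (BT.mk _ π z p) = BT.insert ρ σ τ π h z p :=
  BT.lift_mk _ _ z p

/-- Left multiplication in `H`, pulled back along an algebra map. -/
def lmulL {H : Type*} [Ring H] [Algebra k H] (f : B →ₐ[k] H) : LAct k B H :=
  (Algebra.lmul k H).comp f

/-- Right multiplication in `H`, pulled back along an algebra map `f : B → H`, is a right action. -/
def rmulR {H : Type*} [Ring H] [Algebra k H] (f : B →ₐ[k] H) : RAct k B H :=
  (Algebra.lsmul k k H).comp (AlgHom.op f)

/-- Left multiplication in `H` by `f b`, for an anti-homomorphism `f`, is a right action. -/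
def lmulR {H : Type*} [Ring H] [Algebra k H] (f : Bᵐᵒᵖ →ₐ[k] H) : RAct k B H :=
  (Algebra.lmul k H).comp f

/-- Right multiplication in `H` by `f b`, for an anti-homomorphism `f`, is a left action. -/
def rmulL {H : Type*} [Ring H] [Algebra k H] (f : Bᵐᵒᵖ →ₐ[k] H) : LAct k B H :=
  (Algebra.lsmul k k H).comp (AlgHom.opComm.symm f)

/-- The bilinear map `(y, x) ↦ x y`. -/
def mulFlip (k H : Type*) [CommRing k] [Ring H] [Algebra k H] : H →ₗ[k] H →ₗ[k] H :=
  (LinearMap.mul k H).flip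

@[simp] theorem mulFlip_apply {H : Type*} [Ring H] [Algebra k H] (x y : H) :
    mulFlip k H y x = x * y := (rfl)

@[simp] theorem lmulL_apply {H : Type*} [Ring H] [Algebra k H] (f : B →ₐ[k] H) (b : B) (h : H) :
    lmulL f b h = f b * h := (rfl)

@[simp] theorem rmulR_apply {H : Type*} [Ring H] [Algebra k H] (f : B →ₐ[k] H) (b : B) (h : H) :
    rmulR f (op b) h = h * f b := (rfl)

@[simp] theorem lmulR_apply {H : Type*} [Ring H] [Algebra k H] (f : Bᵐᵒᵖ →ₐ[k] H) (b : Bᵐᵒᵖ)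
    (h : H) : lmulR f b h = f b * h := (rfl)

@[simp] theorem rmulL_apply {H : Type*} [Ring H] [Algebra k H] (f : Bᵐᵒᵖ →ₐ[k] H) (b : B) (h : H) :
    rmulL f b h = h * f (op b) := (rfl)

section Equivariance

variable {H : Type*} [Ring H] [Algebra k H]

theorem mulRight_lmulR (f : Bᵐᵒᵖ →ₐ[k] H) (y : H) (b : Bᵐᵒᵖ) (h : H) :
    LinearMap.mulRight k y (lmulR f b h) = lmulR f b (LinearMap.mulRight k y h) := by
  simp [mul_assoc]

theorem mulRight_lmulL (f : B →ₐ[k] H) (y : H) (b : B) (h : H) :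
    LinearMap.mulRight k y (lmulL f b h) = lmulL f b (LinearMap.mulRight k y h) := by
  simp [mul_assoc]

theorem mulLeft_rmulR (f : B →ₐ[k] H) (y : H) (b : Bᵐᵒᵖ) (h : H) :
    LinearMap.mulLeft k y (rmulR f b h) = rmulR f b (LinearMap.mulLeft k y h) := by
  induction b; simp [mul_assoc]

theorem mulLeft_rmulL (f : Bᵐᵒᵖ →ₐ[k] H) (y : H) (b : B) (h : H) :
    LinearMap.mulLeft k y (rmulL f b h) = rmulL f b (LinearMap.mulLeft k y h) := by
  simp [mul_assoc]

theorem mulFlip_lmulR (f : Bᵐᵒᵖ →ₐ[k] H) (y : H) (b : Bᵐᵒᵖ) (h : H) :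
    mulFlip k H y (lmulR f b h) = lmulR f b (mulFlip k H y h) := by
  simp [mul_assoc]

theorem mulFlip_lmulL (f : B →ₐ[k] H) (y : H) (b : B) (h : H) :
    mulFlip k H y (lmulL f b h) = lmulL f b (mulFlip k H y h) := by
  simp [mul_assoc]

theorem mul_rmulR (f : B →ₐ[k] H) (y : H) (b : Bᵐᵒᵖ) (h : H) :
    LinearMap.mul k H y (rmulR f b h) = rmulR f b (LinearMap.mul k H y h) := by
  induction b; simp [mul_assoc]

theorem mul_rmulL (f : Bᵐᵒᵖ →ₐ[k] H) (y : H) (b : B) (h : H) :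
    LinearMap.mul k H y (rmulL f b h) = rmulL f b (LinearMap.mul k H y h) := by
  simp [mul_assoc]

theorem flip_act {M A : Type*} [AddCommGroup M] [Module k M] [AddCommGroup A] [Module k A]
    {mu : M →ₗ[k] A →ₗ[k] M} {ρ : RAct k B M}
    (h : ∀ a (b : Bᵐᵒᵖ) m, mu (ρ b m) a = ρ b (mu m a)) (a : A) (b : Bᵐᵒᵖ) (m : M) :
    mu.flip a (ρ b m) = ρ b (mu.flip a m) := by
  simp [h]

end Equivariance

end BT

/-! ### Corings and comodules -/

section Coring

variable {k : Type*} [CommRing k] {B : Type*} [Ring B] [Algebra k B]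
  {C : Type*} [Ring C] [Algebra k C]
  {M : Type*} [AddCommGroup M] [Module k M] {N : Type*} [AddCommGroup N] [Module k N]
  {P : Type*} [AddCommGroup P] [Module k P]

/-- Let `M` be a right `B`- and right `C`-module, `N` a `B`-`C` bimodule, `P` a left `C`-module, and
let `coB : M → M ⊗_B N`, `coC : M → M ⊗_C P` and `Δ : N → N ⊗_C P` be maps. The condition says that
`coB` is right `C`-linear, that `Δ` is left `B`-linear, and that
`(coB ⊗_C P) ∘ coC = (M ⊗_B Δ) ∘ coB` as maps `M → M ⊗_B N ⊗_C P`. -/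
structure Coassoc (rB : RAct k B M) (rC : RAct k C M) (lN : LAct k B N) (rN : RAct k C N)
    (lP : LAct k C P) (comm : ∀ b (c : Cᵐᵒᵖ) n, lN b (rN c n) = rN c (lN b n))
    (coB : M →ₗ[k] BT rB lN) (coC : M →ₗ[k] BT rC lP) (Δ : N →ₗ[k] BT rN lP) : Prop where
  right_linear : ∀ (c : Cᵐᵒᵖ) m, coB (rC c m) = BT.rightAct rB lN rN comm c (coB m)
  left_linear : ∀ b n, Δ (lN b n) = BT.leftAct rN lP lN comm b (Δ n)
  coassoc : ∀ m, BT.assoc rB lN rN lP comm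
      (BT.map coB LinearMap.id right_linear (fun _ _ => rfl) (coC m)) =
    BT.map LinearMap.id Δ (fun _ _ => rfl) left_linear (coB m)

/-- For a right `B`-module `M` and a left `B`-linear map `ε : N → B`, the composite of
`M ⊗_B ε` with the isomorphism `M ⊗_B B ≅ M`, that is, `m ⊗ n ↦ m ε(n)`. -/
def BT.contr (rM : RAct k B M) (lN : LAct k B N) (ε : N →ₗ[k] B)
    (hε : ∀ b n, ε (lN b n) = b * ε n) : BT rM lN →ₗ[k] M :=
  BT.lift (rM.toLinearMap ∘ₗ (opLinearEquiv k).toLinearMap ∘ₗ ε).flip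
    (fun b m n => by simp [hε])

@[simp] theorem BT.contr_mk (rM : RAct k B M) (lN : LAct k B N) (ε : N →ₗ[k] B)
    (hε : ∀ b n, ε (lN b n) = b * ε n) (m : M) (n : N) :
    BT.contr rM lN ε hε (BT.mk rM lN m n) = rM (op (ε n)) m :=
  BT.lift_mk _ _ m n

/-- The `B`-`B` bimodule `N` is a `B`-coring with coproduct `Δ` and counit `ε`. -/
structure IsCoring (l : LAct k B N) (r : RAct k B N) (Δ : N →ₗ[k] BT r l) (ε : N →ₗ[k] B) :
    Prop where
  comm : ∀ b (b' : Bᵐᵒᵖ) n, l b (r b' n) = r b' (l b n)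
  coassoc : Coassoc r r l r l comm Δ Δ Δ
  counit_left : ∀ b n, ε (l b n) = b * ε n
  counit_right : ∀ b n, ε (r (op b) n) = ε n * b
  counit_comul : ∀ n, BT.lift (l.toLinearMap ∘ₗ ε)
    (fun b m n => by simp [counit_right]) (Δ n) = n
  comul_counit : ∀ n, BT.contr r l ε counit_left (Δ n) = n

/-- `co : M → M ⊗_B N` is a right coaction of the `B`-coring `N` on the right `B`-module `M`. -/
structure IsComodule {l : LAct k B N} {r : RAct k B N} {Δ : N →ₗ[k] BT r l} {ε : N →ₗ[k] B}
    (hN : IsCoring l r Δ ε) (rM : RAct k B M) (co : M →ₗ[k] BT rM l) : Prop where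
  coassoc : Coassoc rM rM l r l hN.comm co co Δ
  counit : ∀ m, BT.contr rM l ε hN.counit_left (co m) = m

end Coring

/-! ### Bialgebroids and Hopf algebroids -/

section Bialgebroid

variable (k : Type*) [CommRing k] (L : Type*) [Ring L] [Algebra k L] (R : Type*) [Ring R]
  [Algebra k R] (H : Type*) [Ring H] [Algebra k H]

/-- A left bialgebroid `(H, s, t, Δ, ε)` over the `k`-algebra `L`. The bimodule structure of the
underlying `L`-coring is `l h l' = s(l) t(l') h`. -/
structure LeftBialgebroid where
  /-- source map -/
  s : L →ₐ[k] H
  /-- target map, an anti-homomorphism -/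
  t : Lᵐᵒᵖ →ₐ[k] H
  commute : ∀ l l', s l * t l' = t l' * s l
  /-- coproduct -/
  Δ : H →ₗ[k] BT (lmulR t) (lmulL s)
  /-- counit -/
  ε : H →ₗ[k] L
  isCoring : IsCoring (lmulL s) (lmulR t) Δ ε
  /-- `h₁ t(l) ⊗ h₂ = h₁ ⊗ h₂ s(l)` -/
  takeuchi : ∀ l h, BT.map (LinearMap.mulRight k (t (op l))) LinearMap.id
      (mulRight_lmulR t _) (fun _ _ => rfl) (Δ h) =
    BT.map LinearMap.id (LinearMap.mulRight k (s l)) (fun _ _ => rfl)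
      (mulRight_lmulL s _) (Δ h)
  Δ_one : Δ 1 = BT.mk _ _ 1 1
  /-- `Δ(h h') = h₁ h'₁ ⊗ h₂ h'₂` -/
  Δ_mul : ∀ h h', Δ (h * h') = BT.lift
    (BT.bimap (mulFlip k H) (mulFlip k H) (mulFlip_lmulR t) (mulFlip_lmulL s) (Δ h))
    (fun l _ _ => BT.bimap_bal _ _ _ _ (takeuchi l h) (fun _ => by simp [mul_assoc])
      (fun _ => by simp [mul_assoc])) (Δ h')
  ε_one : ε 1 = 1
  ε_mul_s : ∀ h h', ε (h * s (ε h')) = ε (h * h')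
  ε_mul_t : ∀ h h', ε (h * t (op (ε h'))) = ε (h * h')

/-- A right bialgebroid `(H, s, t, Δ, ε)` over the `k`-algebra `R`. The bimodule structure of the
underlying `R`-coring is `r h r' = h s(r') t(r)`. -/
structure RightBialgebroid where
  /-- source map -/
  s : R →ₐ[k] H
  /-- target map, an anti-homomorphism -/
  t : Rᵐᵒᵖ →ₐ[k] H
  commute : ∀ r r', s r * t r' = t r' * s r
  /-- coproduct -/
  Δ : H →ₗ[k] BT (rmulR s) (rmulL t)
  /-- counit -/
  ε : H →ₗ[k] R
  isCoring : IsCoring (rmulL t) (rmulR s) Δ ε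
  /-- `s(r) h₁ ⊗ h₂ = h₁ ⊗ t(r) h₂` -/
  takeuchi : ∀ r h, BT.map (LinearMap.mulLeft k (s r)) LinearMap.id
      (mulLeft_rmulR s _) (fun _ _ => rfl) (Δ h) =
    BT.map LinearMap.id (LinearMap.mulLeft k (t (op r))) (fun _ _ => rfl)
      (mulLeft_rmulL t _) (Δ h)
  Δ_one : Δ 1 = BT.mk _ _ 1 1
  /-- `Δ(h h') = h₁ h'₁ ⊗ h₂ h'₂` -/
  Δ_mul : ∀ h h', Δ (h * h') = BT.lift
    (BT.bimap (LinearMap.mul k H) (LinearMap.mul k H) (mul_rmulR s) (mul_rmulL t) (Δ h'))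
    (fun r _ _ => BT.bimap_bal _ _ _ _ (takeuchi r h') (fun _ => by simp [mul_assoc])
      (fun _ => by simp [mul_assoc])) (Δ h)
  ε_one : ε 1 = 1
  ε_s_mul : ∀ h h', ε (s (ε h) * h') = ε (h * h')
  ε_t_mul : ∀ h h', ε (t (op (ε h)) * h') = ε (h * h')

variable {k L R H} in
theorem lmulL_rmulR_comm (f : L →ₐ[k] H) (g : R →ₐ[k] H) (l : L) (r : Rᵐᵒᵖ) (h : H) :
    lmulL f l (rmulR g r h) = rmulR g r (lmulL f l h) := by
  induction r; simp [mul_assoc]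

variable {k L R H} in
theorem rmulL_lmulR_comm (f : Rᵐᵒᵖ →ₐ[k] H) (g : Lᵐᵒᵖ →ₐ[k] H) (r : R) (l : Lᵐᵒᵖ) (h : H) :
    rmulL f r (lmulR g l h) = lmulR g l (rmulL f r h) := by
  simp [mul_assoc]

/-- A Hopf algebroid with total algebra `H` over the base algebras `L` and `R`. The antipode is not
required to be bijective, and no purity is required. -/
structure HopfAlgebroid where
  /-- the constituent left bialgebroid -/
  left : LeftBialgebroid k L H
  /-- the constituent right bialgebroid -/
  right : RightBialgebroid k R H
  /-- the antipode -/
  S : H →ₗ[k] H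
  s_ε_t_left : ∀ r, left.s (left.ε (right.t (op r))) = right.t (op r)
  t_ε_s_left : ∀ r, left.t (op (left.ε (right.s r))) = right.s r
  s_ε_t_right : ∀ l, right.s (right.ε (left.t (op l))) = left.t (op l)
  t_ε_s_right : ∀ l, right.t (op (right.ε (left.s l))) = left.s l
  /-- `(Δ_L ⊗_R H) ∘ Δ_R = (H ⊗_L Δ_R) ∘ Δ_L` -/
  coassoc_left_right : Coassoc (lmulR left.t) (rmulR right.s) (lmulL left.s) (rmulR right.s)
    (rmulL right.t) (lmulL_rmulR_comm _ _) left.Δ right.Δ right.Δ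
  /-- `(Δ_R ⊗_L H) ∘ Δ_L = (H ⊗_R Δ_L) ∘ Δ_R` -/
  coassoc_right_left : Coassoc (rmulR right.s) (lmulR left.t) (rmulL right.t) (lmulR left.t)
    (lmulL left.s) (rmulL_lmulR_comm _ _) right.Δ left.Δ left.Δ
  S_twist : ∀ l r h, S (left.t (op l) * h * right.t (op r)) = right.s r * S h * left.s l
  /-- `S(h₁) h₂ = s_R(ε_R(h))` for the coproduct of the left bialgebroid -/
  antipode_left : ∀ h, BT.lift ((LinearMap.mul k H).comp S)
    (fun l x y => by simpa [mul_assoc] using congrArg (· * y) (S_twist l 1 x)) (left.Δ h) = right.s (right.ε h)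
  /-- `h₁ S(h₂) = s_L(ε_L(h))` for the coproduct of the right bialgebroid -/
  antipode_right : ∀ h, BT.lift ((LinearMap.mul k H).compl₂ S)
    (fun r x y => by simpa [mul_assoc] using congrArg (x * ·) (S_twist 1 r y).symm) (right.Δ h) = left.s (left.ε h)

end Bialgebroid

section Coring

variable {k : Type*} [CommRing k] {B : Type*} [Ring B] [Algebra k B]
  {M : Type*} [AddCommGroup M] [Module k M] {N : Type*} [AddCommGroup N] [Module k N]

/-- If `u` is an endomorphism of a comodule `M` with `co(u m) = m₀ ⊗ v(m₁)`, and
`v(n₁) ⊗ n₂ = n₁ ⊗ v'(n₂)` in the coring, then `u(m₀) ⊗ m₁ = m₀ ⊗ v'(m₁)`. -/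
theorem IsComodule.takeuchi {l : LAct k B N} {r : RAct k B N} {Δ : N →ₗ[k] BT r l} {ε : N →ₗ[k] B}
    {hN : IsCoring l r Δ ε} {rM : RAct k B M} {co : M →ₗ[k] BT rM l} (h : IsComodule hN rM co)
    (u : M →ₗ[k] M) (hu : ∀ (b : Bᵐᵒᵖ) m, u (rM b m) = rM b (u m)) (v v' : N →ₗ[k] N)
    (hvl : ∀ b n, v (l b n) = l b (v n)) (hvr : ∀ (b : Bᵐᵒᵖ) n, v (r b n) = r b (v n))
    (hvl' : ∀ b n, v' (l b n) = l b (v' n))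
    (hΔ : ∀ n, BT.map (ρ' := r) (σ' := l) v LinearMap.id hvr (fun _ _ => rfl) (Δ n) =
      BT.map LinearMap.id v' (fun _ _ => rfl) hvl' (Δ n))
    (huv : ∀ m, co (u m) = BT.map LinearMap.id v (fun _ _ => rfl) hvl (co m)) (m : M) :
    BT.map (ρ' := rM) (σ' := l) u LinearMap.id hu (fun _ _ => rfl) (co m) =
      BT.map LinearMap.id v' (fun _ _ => rfl) hvl' (co m) := by
  let e : BT r l →ₗ[k] N := BT.lift (l.toLinearMap ∘ₗ ε)
    (fun b m n => by simp [hN.counit_right])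
  have he : ∀ a b, e (BT.mk r l a b) = l (ε a) b := fun a b => BT.lift_mk _ _ a b
  let φ : BT r l →ₗ[k] N := e ∘ₗ BT.map v LinearMap.id hvr (fun _ _ => rfl)
  have hφ : ∀ a b, φ (BT.mk r l a b) = l (ε (v a)) b := fun a b => by simp [φ, he]
  have hφl : ∀ b z, φ (BT.leftAct r l l hN.comm b z) = l b (φ z) := fun b z => by
    induction z using BT.induction with
    | hm m n => simp [hφ, hvl, hN.counit_left]
    | h0 => simp
    | ha x y hx hy => simp only [map_add, hx, hy]
  have hφΔ : ∀ n, φ (Δ n) = v' n := fun n => by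
    have h1 : ∀ z, e (BT.map LinearMap.id v' (fun _ _ => rfl) hvl' z) = v' (e z) := fun z => by
      induction z using BT.induction with
      | hm m n => simp [he, hvl']
      | h0 => simp
      | ha x y hx hy => simp only [map_add, hx, hy]
    calc φ (Δ n) = e (BT.map LinearMap.id v' (fun _ _ => rfl) hvl' (Δ n)) := by
          simp only [φ, LinearMap.comp_apply, hΔ]
      _ = v' n := by rw [h1, show e (Δ n) = n from hN.counit_comul n]
  have key := congrArg (BT.map (ρ' := rM) (σ' := l) LinearMap.id φ (fun _ _ => rfl) hφl)
    (h.coassoc.coassoc m)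
  have hR : ∀ x, BT.map (ρ' := rM) (σ' := l) LinearMap.id φ (fun _ _ => rfl) hφl
      (BT.map LinearMap.id Δ (fun _ _ => rfl) h.coassoc.left_linear x) =
      BT.map LinearMap.id v' (fun _ _ => rfl) hvl' x := fun x => by
    induction x using BT.induction with
    | hm m n => simp [hφΔ]
    | h0 => simp
    | ha x y hx hy => simp only [map_add, hx, hy]
  have hL0 : ∀ y p, BT.map (ρ' := rM) (σ' := l) LinearMap.id φ (fun _ _ => rfl) hφl
      (BT.insert rM l r l hN.comm y p) =
      BT.mk rM l (BT.contr rM l ε hN.counit_left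
        (BT.map LinearMap.id v (fun _ _ => rfl) hvl y)) p := fun y p => by
    induction y using BT.induction with
    | hm m n => simp [hφ, BT.mk_bal]
    | h0 => simp
    | ha x y hx hy => simp only [map_add, LinearMap.add_apply, hx, hy]
  have hL : ∀ z, BT.map (ρ' := rM) (σ' := l) LinearMap.id φ (fun _ _ => rfl) hφl
      (BT.assoc rM l r l hN.comm
        (BT.map co LinearMap.id h.coassoc.right_linear (fun _ _ => rfl) z)) =
      BT.map u LinearMap.id hu (fun _ _ => rfl) z := fun z => by
    induction z using BT.induction with
    | hm m n =>
      rw [BT.map_mk, BT.assoc_mk, LinearMap.id_apply, hL0, ← huv, h.counit]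
      simp
    | h0 => simp
    | ha x y hx hy => simp only [map_add, hx, hy]
  rw [hR, hL] at key
  exact key

end Coring

section Comodule

variable {k : Type*} [CommRing k] {L : Type*} [Ring L] [Algebra k L] {R : Type*} [Ring R]
  [Algebra k R] {H : Type*} [Ring H] [Algebra k H]

namespace HopfAlgebroid

variable (𝓗 : HopfAlgebroid k L R H)

/-- left `L`-action `l h = s_L(l) h` -/
abbrev lL : LAct k L H := lmulL 𝓗.left.s
/-- right `L`-action `h l = t_L(l) h` -/
abbrev rL : RAct k L H := lmulR 𝓗.left.t
/-- left `R`-action `r h = h t_R(r)` -/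
abbrev lR : LAct k R H := rmulL 𝓗.right.t
/-- right `R`-action `h r = h s_R(r)` -/
abbrev rR : RAct k R H := rmulR 𝓗.right.s

theorem ε_s_right (r : R) : 𝓗.right.ε (𝓗.right.s r) = r := by
  simpa [𝓗.right.ε_one] using 𝓗.right.isCoring.counit_right r 1

theorem ε_s_left (l : L) : 𝓗.left.ε (𝓗.left.s l) = l := by
  simpa [𝓗.left.ε_one] using 𝓗.left.isCoring.counit_left l 1

end HopfAlgebroid

/-- A right comodule `M` of the Hopf algebroid: a right `R`- and right `L`-module, with a coaction
`coR : m ↦ m⁰ ⊗_R m¹` of the right bialgebroid and a coaction `coL : m ↦ m₀ ⊗_L m₁` of the left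
bialgebroid, each being a comodule map for the other one. -/
structure HComodule (𝓗 : HopfAlgebroid k L R H) (M : Type*) [AddCommGroup M] [Module k M] where
  /-- right `R`-action -/
  actR : RAct k R M
  /-- right `L`-action -/
  actL : RAct k L M
  /-- coaction of the right bialgebroid -/
  coR : M →ₗ[k] BT actR 𝓗.lR
  /-- coaction of the left bialgebroid -/
  coL : M →ₗ[k] BT actL 𝓗.lL
  isComoduleR : IsComodule 𝓗.right.isCoring actR coR
  isComoduleL : IsComodule 𝓗.left.isCoring actL coL
  /-- `coR(m l) = m⁰ ⊗_R t_L(l) m¹` and `(coR ⊗_L H) ∘ coL = (M ⊗_R Δ_L) ∘ coR` -/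
  coassocRL : Coassoc actR actL 𝓗.lR 𝓗.rL 𝓗.lL (rmulL_lmulR_comm _ _) coR coL 𝓗.left.Δ
  /-- `coL(m r) = m₀ ⊗_L m₁ s_R(r)` and `(coL ⊗_R H) ∘ coR = (M ⊗_L Δ_R) ∘ coL` -/
  coassocLR : Coassoc actL actR 𝓗.lL 𝓗.rR 𝓗.lR (lmulL_rmulR_comm _ _) coL coR 𝓗.right.Δ

namespace HComodule

variable {𝓗 : HopfAlgebroid k L R H} {M : Type*} [AddCommGroup M] [Module k M]
  {M' : Type*} [AddCommGroup M'] [Module k M'] {A : Type*} [AddCommGroup A] [Module k A]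

/-- A `k`-linear map is a morphism of `𝓗`-comodules if it is right `R`- and right `L`-linear and
commutes with both coactions. -/
structure IsHom (X : HComodule 𝓗 M) (X' : HComodule 𝓗 M') (f : M →ₗ[k] M') : Prop where
  actR : ∀ (r : Rᵐᵒᵖ) m, f (X.actR r m) = X'.actR r (f m)
  actL : ∀ (l : Lᵐᵒᵖ) m, f (X.actL l m) = X'.actL l (f m)
  coR : ∀ m, X'.coR (f m) = BT.map f LinearMap.id actR (fun _ _ => rfl) (X.coR m)
  coL : ∀ m, X'.coL (f m) = BT.map f LinearMap.id actL (fun _ _ => rfl) (X.coL m)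

theorem act_comm (X : HComodule 𝓗 M) (r : Rᵐᵒᵖ) (l : Lᵐᵒᵖ) (m : M) :
    X.actR r (X.actL l m) = X.actL l (X.actR r m) := by
  have h : ∀ z, BT.rightAct X.actR 𝓗.lR 𝓗.rR 𝓗.right.isCoring.comm r
      (BT.rightAct X.actR 𝓗.lR 𝓗.rL (rmulL_lmulR_comm _ _) l z) =
      BT.rightAct X.actR 𝓗.lR 𝓗.rL (rmulL_lmulR_comm _ _) l
      (BT.rightAct X.actR 𝓗.lR 𝓗.rR 𝓗.right.isCoring.comm r z) := fun z => by
    induction z using BT.induction with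
    | hm m n => induction r; simp [mul_assoc]
    | h0 => simp
    | ha x y hx hy => simp only [map_add, hx, hy]
  have e : X.coR (X.actR r (X.actL l m)) = X.coR (X.actL l (X.actR r m)) := by
    rw [X.isComoduleR.coassoc.right_linear, X.coassocRL.right_linear, X.coassocRL.right_linear,
      X.isComoduleR.coassoc.right_linear]
    exact h _
  rw [← X.isComoduleR.counit (X.actR r _), e, X.isComoduleR.counit]

/-- `m⁰ l ⊗_R m¹ = m⁰ ⊗_R t_R(r) m¹` for `r = ε_R(t_L(l))` -/
theorem takeuchiR (X : HComodule 𝓗 M) (l : L) (m : M) :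
    BT.map (ρ' := X.actR) (σ' := 𝓗.lR) (X.actL (op l)) LinearMap.id
      (fun r m => (X.act_comm r (op l) m).symm) (fun _ _ => rfl) (X.coR m) =
    BT.map LinearMap.id
      (LinearMap.mulLeft k (𝓗.right.t (op (𝓗.right.ε (𝓗.left.t (op l))))))
      (fun _ _ => rfl) (mulLeft_rmulL _ _) (X.coR m) := by
  refine X.isComoduleR.takeuchi _ _ (LinearMap.mulLeft k (𝓗.left.t (op l))) _
    (mulLeft_rmulL _ _) (mulLeft_rmulR _ _) _ (fun h => ?_)
    (fun m => X.coassocRL.right_linear (op l) m) m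
  have := 𝓗.right.takeuchi (𝓗.right.ε (𝓗.left.t (op l))) h
  simp only [𝓗.s_ε_t_right] at this
  exact this

/-- `m₀ r ⊗_L m₁ = m₀ ⊗_L m₁ s_L(l)` for `r = ε_R(t_L(l))` -/
theorem takeuchiL (X : HComodule 𝓗 M) (l : L) (m : M) :
    BT.map (ρ' := X.actL) (σ' := 𝓗.lL) (X.actR (op (𝓗.right.ε (𝓗.left.t (op l))))) LinearMap.id
      (fun _ _ => X.act_comm _ _ _) (fun _ _ => rfl) (X.coL m) =
    BT.map LinearMap.id (LinearMap.mulRight k (𝓗.left.s l))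
      (fun _ _ => rfl) (mulRight_lmulL _ _) (X.coL m) := by
  refine X.isComoduleL.takeuchi _ _ (LinearMap.mulRight k (𝓗.left.t (op l))) _
    (mulRight_lmulL _ _) (mulRight_lmulR _ _) _
    (fun h => 𝓗.left.takeuchi l h) (fun m => ?_) m
  rw [X.coassocLR.right_linear]
  have : LinearMap.mulRight k (𝓗.left.t (op l)) =
      𝓗.rR (op (𝓗.right.ε (𝓗.left.t (op l)))) := by
    ext; simp [𝓗.s_ε_t_right]
  simp only [this]
  rfl

end HComodule

end Comodule

/-! ### Comodule algebras, coinvariants, cleft extensions -/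

section ComoduleAlgebra

variable {k : Type*} [CommRing k] {L : Type*} [Ring L] [Algebra k L] {R : Type*} [Ring R]
  [Algebra k R] {H : Type*} [Ring H] [Algebra k H]

namespace HopfAlgebroid

variable (𝓗 : HopfAlgebroid k L R H)

theorem ε_t_left (l : L) : 𝓗.left.ε (𝓗.left.t (op l)) = l := by
  simpa [𝓗.left.ε_one] using 𝓗.left.isCoring.counit_right l 1

theorem ε_t_ε_s (r : R) : 𝓗.right.ε (𝓗.left.t (op (𝓗.left.ε (𝓗.right.s r)))) = r := by
  rw [𝓗.t_ε_s_left, 𝓗.ε_s_right]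

theorem ε_s_ε_t (l : L) : 𝓗.left.ε (𝓗.right.s (𝓗.right.ε (𝓗.left.t (op l)))) = l := by
  rw [𝓗.s_ε_t_right, 𝓗.ε_t_left]

theorem S_one : 𝓗.S 1 = 1 := by
  have h := 𝓗.antipode_left 1
  rw [𝓗.left.Δ_one, 𝓗.right.ε_one, BT.lift_mk] at h
  simpa using h

/-- The regular comodule `H`, with the coproducts as coactions. -/
def regularComodule : HComodule 𝓗 H where
  actR := 𝓗.rR
  actL := 𝓗.rL
  coR := 𝓗.right.Δ
  coL := 𝓗.left.Δ
  isComoduleR := ⟨𝓗.right.isCoring.coassoc, 𝓗.right.isCoring.comul_counit⟩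
  isComoduleL := ⟨𝓗.left.isCoring.coassoc, 𝓗.left.isCoring.comul_counit⟩
  coassocRL := 𝓗.coassoc_right_left
  coassocLR := 𝓗.coassoc_left_right

end HopfAlgebroid

namespace HComodule

variable {𝓗 : HopfAlgebroid k L R H} {M : Type*} [AddCommGroup M] [Module k M]
  {A : Type*} [AddCommGroup A] [Module k A]

/-- The map `mu : M × A → M` induces a morphism of `𝓗`-comodules `M ⊗_R A → M`. Here `M ⊗_R A` is
the tensor product in the monoidal category of `𝓗`-comodules: it is taken over `R`, where the left
`R`-action on a comodule is `r a = a ε_L(s_R(r))`, its right `R`-action is that of `A`, its right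
`L`-action is that of `M`, and its coactions are `m ⊗ a ↦ m⁰ ⊗ a⁰ ⊗_R m¹ a¹` and
`m ⊗ a ↦ m₀ ⊗ a₀ ⊗_L m₁ a₁`. -/
structure IsAction (X : HComodule 𝓗 M) (Z : HComodule 𝓗 A) (mu : M →ₗ[k] A →ₗ[k] M) : Prop where
  balanced : ∀ (r : R) m a,
    mu (X.actR (op r) m) a = mu m (Z.actL (op (𝓗.left.ε (𝓗.right.s r))) a)
  actR : ∀ m (r : Rᵐᵒᵖ) a, mu m (Z.actR r a) = X.actR r (mu m a)
  actL : ∀ a (l : Lᵐᵒᵖ) m, mu (X.actL l m) a = X.actL l (mu m a)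
  /-- `coR(m a) = m⁰ a⁰ ⊗_R m¹ a¹` -/
  coR : ∀ m a, X.coR (mu m a) = BT.lift
    (BT.bimap mu (LinearMap.mul k H) actR (mul_rmulL _) (Z.coR a))
    (fun r _ _ => BT.bimap_bal _ _ _ _ (Z.takeuchiR (𝓗.left.ε (𝓗.right.s r)) a)
      (balanced r _) (fun _ => by simp [mul_assoc, 𝓗.ε_t_ε_s])) (X.coR m)
  /-- `coL(m a) = m₀ a₀ ⊗_L m₁ a₁` -/
  coL : ∀ m a, X.coL (mu m a) = BT.lift
    (BT.bimap mu.flip (mulFlip k H) (flip_act actL) (mulFlip_lmulL _) (X.coL m))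
    (fun l _ _ => BT.bimap_bal _ _ _ _ (X.takeuchiL l m)
      (fun _ => by simp [balanced, 𝓗.ε_s_ε_t]) (fun _ => by simp [mul_assoc])) (Z.coL a)

/-- An element which is coinvariant for the right bialgebroid is also coinvariant for the left
bialgebroid. -/
theorem coinvL (X : HComodule 𝓗 M) {m : M} (hm : X.coR m = BT.mk _ _ m 1) :
    X.coL m = BT.mk _ _ m 1 := by
  have hS : ∀ (r : R) h, 𝓗.S (𝓗.lR r h) = 𝓗.right.s r * 𝓗.S h := fun r h => by
    simpa using 𝓗.S_twist 1 r h
  let ψ : BT 𝓗.rR 𝓗.lR →ₗ[k] H := BT.lift ((LinearMap.mul k H).compl₂ 𝓗.S) (fun r x y => by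
    simp [← hS, mul_assoc])
  have hψ : ∀ x y, ψ (BT.mk _ _ x y) = x * 𝓗.S y := fun x y => BT.lift_mk _ _ x y
  have hψΔ : ∀ h, ψ (𝓗.right.Δ h) = 𝓗.left.s (𝓗.left.ε h) := 𝓗.antipode_right
  have hψl : ∀ b z, ψ (BT.leftAct 𝓗.rR 𝓗.lR 𝓗.lL (lmulL_rmulR_comm _ _) b z) = 𝓗.lL b (ψ z) :=
    fun b z => by
      induction z using BT.induction with
      | hm m n => simp [hψ, mul_assoc]
      | h0 => simp
      | ha x y hx hy => simp only [map_add, hx, hy]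
  have key := congrArg (BT.map (ρ' := X.actL) (σ' := 𝓗.lL) LinearMap.id ψ (fun _ _ => rfl) hψl)
    (X.coassocLR.coassoc m)
  rw [hm] at key
  have hR : ∀ z, BT.map (ρ' := X.actL) (σ' := 𝓗.lL) LinearMap.id ψ (fun _ _ => rfl) hψl
      (BT.map LinearMap.id 𝓗.right.Δ (fun _ _ => rfl) X.coassocLR.left_linear z) =
      BT.mk _ _ (BT.contr X.actL 𝓗.lL 𝓗.left.ε 𝓗.left.isCoring.counit_left z) 1 := fun z => by
    induction z using BT.induction with
    | hm m n => simp [hψΔ, BT.mk_bal]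
    | h0 => simp
    | ha x y hx hy => simp only [map_add, LinearMap.add_apply, hx, hy]
  have hL : ∀ z, BT.map (ρ' := X.actL) (σ' := 𝓗.lL) LinearMap.id ψ (fun _ _ => rfl) hψl
      (BT.insert X.actL 𝓗.lL 𝓗.rR 𝓗.lR (lmulL_rmulR_comm _ _) z 1) = z := fun z => by
    induction z using BT.induction with
    | hm m n => simp [hψ, 𝓗.S_one]
    | h0 => simp
    | ha x y hx hy => simp only [map_add, LinearMap.add_apply, hx, hy]
  rw [hR, X.isComoduleL.counit, BT.map_mk, BT.assoc_mk, LinearMap.id_apply, hL] at key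
  exact key

end HComodule

/-- A comodule algebra of the Hopf algebroid, that is, a monoid in the monoidal category of
`𝓗`-comodules: an `R`-ring `A` which is an `𝓗`-comodule whose underlying `R`-`R` bimodule
is that of the `R`-ring (the left action being `r a = a ε_L(s_R(r))`), such that the
multiplication `A ⊗_R A → A` and the unit `R → A` are comodule maps. -/
structure ComoduleAlgebra (𝓗 : HopfAlgebroid k L R H) (A : Type*) [Ring A] [Algebra k A] where
  /-- the underlying comodule -/
  com : HComodule 𝓗 A
  /-- the `R`-ring structure -/
  η : R →ₐ[k] A
  actR_eq : ∀ r a, com.actR (op r) a = a * η r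
  actL_eq : ∀ r a, com.actL (op (𝓗.left.ε (𝓗.right.s r))) a = η r * a
  coR_one : com.coR 1 = BT.mk _ _ 1 1
  coL_one : com.coL 1 = BT.mk _ _ 1 1
  isAction : com.IsAction com (LinearMap.mul k A)

/-- The comodule algebra `H`. -/
def HopfAlgebroid.regular (𝓗 : HopfAlgebroid k L R H) : ComoduleAlgebra 𝓗 H where
  com := 𝓗.regularComodule
  η := 𝓗.right.s
  actR_eq _ _ := rfl
  actL_eq r a := by
    change 𝓗.left.t _ * a = _
    rw [𝓗.t_ε_s_left]
  coR_one := 𝓗.right.Δ_one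
  coL_one := 𝓗.left.Δ_one
  isAction :=
    { balanced := fun r m a => by
        change m * 𝓗.right.s r * a = m * (𝓗.left.t _ * a)
        rw [𝓗.t_ε_s_left, mul_assoc]
      actR := fun m r a => (mul_assoc m a _).symm
      actL := fun a l m => mul_assoc _ m a
      coR := 𝓗.right.Δ_mul
      coL := 𝓗.left.Δ_mul }

namespace ComoduleAlgebra

variable {𝓗 : HopfAlgebroid k L R H} {A : Type*} [Ring A] [Algebra k A] (𝒜 : ComoduleAlgebra 𝓗 A)

/-- The subalgebra of coinvariants of the right bialgebroid, `{a | a⁰ ⊗_R a¹ = a ⊗_R 1}`. -/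
def coinvariants : Subalgebra k A where
  carrier := {a | 𝒜.com.coR a = BT.mk _ _ a 1}
  mul_mem' {a b} ha hb := by
    have h := 𝒜.isAction.coR a b
    rw [Set.mem_ofPred_eq] at ha hb
    rw [ha, BT.lift_mk, hb, BT.bimap_mk] at h
    simpa using h
  add_mem' {a b} ha hb := by
    rw [Set.mem_ofPred_eq] at ha hb ⊢
    simp [ha, hb]
  algebraMap_mem' c := by
    simp [Algebra.algebraMap_eq_smul_one, 𝒜.coR_one]

/-- The data exhibiting `T ⊆ A` as a cleft extension, where `T` is the algebra of coinvariants: an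
`L`-ring structure on `A` such that `T` is an `L`-subring, a left `L`-linear `𝓗`-comodule map
`j : H → A`, and a convolution inverse `j'` of `j`, which is left `R`- and right `L`-linear. -/
structure Cleaving where
  /-- the `L`-ring structure -/
  ηL : L →ₐ[k] A
  ηL_mem : ∀ l, ηL l ∈ 𝒜.coinvariants
  /-- the cleaving map -/
  j : H →ₗ[k] A
  j_left : ∀ l h, j (𝓗.left.s l * h) = ηL l * j h
  j_hom : 𝓗.regularComodule.IsHom 𝒜.com j
  /-- the convolution inverse -/
  j' : H →ₗ[k] A
  j'_left : ∀ r h, j' (h * 𝓗.right.t (op r)) = 𝒜.η r * j' h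
  j'_right : ∀ l h, j' (𝓗.left.t (op l) * h) = j' h * ηL l
  /-- `j(h¹) j'(h²) = η_L(ε_L(h))` for the coproduct of the right bialgebroid -/
  j_mul_j' : ∀ h, BT.lift ((LinearMap.mul k A).compl₁₂ j j')
    (fun r x y => by
      have h1 := j_hom.actR (op r) x
      rw [𝒜.actR_eq] at h1
      have h2 := j'_left r y
      change j (𝓗.rR (op r) x) * j' y = j x * j' (y * 𝓗.right.t (op r))
      rw [h2, ← mul_assoc, ← h1]; rfl) (𝓗.right.Δ h) = ηL (𝓗.left.ε h)
  /-- `j'(h₁) j(h₂) = η_R(ε_R(h))` for the coproduct of the left bialgebroid -/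
  j'_mul_j : ∀ h, BT.lift ((LinearMap.mul k A).compl₁₂ j' j)
    (fun l x y => by
      change j' (𝓗.left.t (op l) * x) * j y = j' x * j (𝓗.left.s l * y)
      rw [j'_right, j_left, mul_assoc]) (𝓗.left.Δ h) = 𝒜.η (𝓗.right.ε h)

/-- `T ⊆ A` is an `𝓗`-cleft extension, where `T` is the algebra of coinvariants. -/
def IsCleft : Prop := Nonempty 𝒜.Cleaving

end ComoduleAlgebra

end ComoduleAlgebra

/-! ### The category of Hopf modules -/

section Transport

variable {k : Type*} [CommRing k] {B : Type*} [Ring B] [Algebra k B]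
  {C : Type*} [Ring C] [Algebra k C]
  {M : Type*} [AddCommGroup M] [Module k M] {M' : Type*} [AddCommGroup M'] [Module k M']
  {N : Type*} [AddCommGroup N] [Module k N] {P : Type*} [AddCommGroup P] [Module k P]
  {ι : Type*}

theorem Coassoc.of_maps {rB : RAct k B M} {rC : RAct k C M} {lN : LAct k B N} {rN : RAct k C N}
    {lP : LAct k C P} {comm : ∀ b (c : Cᵐᵒᵖ) n, lN b (rN c n) = rN c (lN b n)}
    {coB : M →ₗ[k] BT rB lN} {coC : M →ₗ[k] BT rC lP} {Δ : N →ₗ[k] BT rN lP}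
    (h : Coassoc rB rC lN rN lP comm coB coC Δ)
    {rB' : RAct k B M'} {rC' : RAct k C M'} {coB' : M' →ₗ[k] BT rB' lN} {coC' : M' →ₗ[k] BT rC' lP}
    (i : ι → M →ₗ[k] M')
    (hi : ∀ p : M' → Prop, (∀ w m, p (i w m)) → p 0 → (∀ x y, p x → p y → p (x + y)) → ∀ z, p z)
    (iB : ∀ w (b : Bᵐᵒᵖ) m, i w (rB b m) = rB' b (i w m))
    (iC : ∀ w (c : Cᵐᵒᵖ) m, i w (rC c m) = rC' c (i w m))
    (hB : ∀ w m, coB' (i w m) = BT.map (i w) LinearMap.id (iB w) (fun _ _ => rfl) (coB m))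
    (hC : ∀ w m, coC' (i w m) = BT.map (i w) LinearMap.id (iC w) (fun _ _ => rfl) (coC m)) :
    Coassoc rB' rC' lN rN lP comm coB' coC' Δ := by
  have hr : ∀ (c : Cᵐᵒᵖ) m, coB' (rC' c m) = BT.rightAct rB' lN rN comm c (coB' m) := by
    intro c m
    refine hi (fun m => coB' (rC' c m) = BT.rightAct rB' lN rN comm c (coB' m)) ?_ (by simp)
      (fun x y hx hy => by simp only [map_add, hx, hy]) m
    intro w m
    rw [← iC, hB, h.right_linear, hB]
    generalize coB m = z
    induction z using BT.induction with
    | hm m n => simp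
    | h0 => simp
    | ha x y hx hy => simp only [map_add, hx, hy]
  refine ⟨hr, h.left_linear, fun m => ?_⟩
  refine hi (fun m => BT.assoc rB' lN rN lP comm
      (BT.map coB' LinearMap.id hr (fun _ _ => rfl) (coC' m)) =
    BT.map LinearMap.id Δ (fun _ _ => rfl) h.left_linear (coB' m)) ?_ (by simp)
      (fun x y hx hy => by simp only [map_add, hx, hy]) m
  intro w m
  have key := congrArg (BT.map (ρ' := rB') (i w) LinearMap.id (iB w) (fun _ _ => rfl))
    (h.coassoc m)
  have h1 : ∀ z p, BT.insert rB' lN rN lP comm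
      (BT.map (i w) LinearMap.id (iB w) (fun _ _ => rfl) z) p =
      BT.map (i w) LinearMap.id (iB w) (fun _ _ => rfl) (BT.insert rB lN rN lP comm z p) := by
    intro z p
    induction z using BT.induction with
    | hm m n => simp
    | h0 => simp
    | ha x y hx hy => simp only [map_add, LinearMap.add_apply, hx, hy]
  have h2 : ∀ z, BT.assoc rB' lN rN lP comm (BT.map coB' LinearMap.id hr (fun _ _ => rfl)
      (BT.map (i w) LinearMap.id (iC w) (fun _ _ => rfl) z)) =
      BT.map (i w) LinearMap.id (iB w) (fun _ _ => rfl) (BT.assoc rB lN rN lP comm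
        (BT.map coB LinearMap.id h.right_linear (fun _ _ => rfl) z)) := by
    intro z
    induction z using BT.induction with
    | hm m n => simp [hB, h1]
    | h0 => simp
    | ha x y hx hy => simp only [map_add, hx, hy]
  have h3 : ∀ z, BT.map LinearMap.id Δ (fun _ _ => rfl) h.left_linear
      (BT.map (ρ' := rB') (σ' := lN) (i w) LinearMap.id (iB w) (fun _ _ => rfl) z) =
      BT.map (i w) LinearMap.id (iB w) (fun _ _ => rfl)
        (BT.map LinearMap.id Δ (fun _ _ => rfl) h.left_linear z) := by
    intro z
    induction z using BT.induction with
    | hm m n => simp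
    | h0 => simp
    | ha x y hx hy => simp only [map_add, hx, hy]
  rw [hB, hC, h2, h3]
  exact key

theorem IsComodule.of_maps {l : LAct k B N} {r : RAct k B N} {Δ : N →ₗ[k] BT r l}
    {ε : N →ₗ[k] B} {hN : IsCoring l r Δ ε} {rM : RAct k B M} {co : M →ₗ[k] BT rM l}
    (h : IsComodule hN rM co) {rM' : RAct k B M'} {co' : M' →ₗ[k] BT rM' l} (i : ι → M →ₗ[k] M')
    (hi : ∀ p : M' → Prop, (∀ w m, p (i w m)) → p 0 → (∀ x y, p x → p y → p (x + y)) → ∀ z, p z)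
    (iB : ∀ w (b : Bᵐᵒᵖ) m, i w (rM b m) = rM' b (i w m))
    (hB : ∀ w m, co' (i w m) = BT.map (i w) LinearMap.id (iB w) (fun _ _ => rfl) (co m)) :
    IsComodule hN rM' co' := by
  refine ⟨h.coassoc.of_maps i hi iB iB hB hB, fun m => ?_⟩
  refine hi (fun m => BT.contr rM' l ε hN.counit_left (co' m) = m) ?_ (by simp)
      (fun x y hx hy => by simp only [map_add, hx, hy]) m
  intro w m
  have h1 : ∀ z, BT.contr rM' l ε hN.counit_left
      (BT.map (i w) LinearMap.id (iB w) (fun _ _ => rfl) z) =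
      i w (BT.contr rM l ε hN.counit_left z) := by
    intro z
    induction z using BT.induction with
    | hm m n => simp [iB]
    | h0 => simp
    | ha x y hx hy => simp only [map_add, hx, hy]
  rw [hB, h1, h.counit]

/-- The bilinear map `(m, a) ↦ m a` of a right action. -/
def RAct.bil (act : RAct k B M) : M →ₗ[k] B →ₗ[k] M :=
  (act.toLinearMap ∘ₗ (opLinearEquiv k).toLinearMap).flip

@[simp] theorem RAct.bil_apply (act : RAct k B M) (m : M) (b : B) :
    act.bil m b = act (op b) m := (rfl)

end Transport

section HopfModule

variable {k : Type u₁} [CommRing k] {L : Type u₂} [Ring L] [Algebra k L] {R : Type u₃} [Ring R]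
  [Algebra k R] {H : Type u₄} [Ring H] [Algebra k H] {𝓗 : HopfAlgebroid k L R H}
  {A : Type u₅} [Ring A] [Algebra k A]

/-- A right `A`-module in the monoidal category of `𝓗`-comodules, i.e. an `𝓗`-comodule `M` with a
right `A`-action that induces a comodule map `M ⊗_R A → M`. -/
structure HopfModule (𝒜 : ComoduleAlgebra 𝓗 A) where
  /-- the underlying `k`-module -/
  carrier : Type v
  [addCommGroup : AddCommGroup carrier]
  [module : Module k carrier]
  /-- the `𝓗`-comodule structure -/
  com : HComodule 𝓗 carrier
  /-- the right `A`-action -/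
  act : RAct k A carrier
  isAction : com.IsAction 𝒜.com act.bil

attribute [instance] HopfModule.addCommGroup HopfModule.module

namespace HopfModule

variable {𝒜 : ComoduleAlgebra 𝓗 A}

/-- Morphisms are the right `A`-linear morphisms of `𝓗`-comodules. -/
@[ext] structure Hom (X Y : HopfModule.{v} 𝒜) where
  /-- the underlying map -/
  map : X.carrier →ₗ[k] Y.carrier
  map_act : ∀ (a : Aᵐᵒᵖ) m, map (X.act a m) = Y.act a (map m)
  isHom : X.com.IsHom Y.com map

end HopfModule

variable {M M' M'' : Type*} [AddCommGroup M] [Module k M] [AddCommGroup M'] [Module k M']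
  [AddCommGroup M''] [Module k M'']

theorem HComodule.IsHom.id (X : HComodule 𝓗 M) : X.IsHom X LinearMap.id where
  actR _ _ := rfl
  actL _ _ := rfl
  coR m := by
    rw [LinearMap.id_apply]
    generalize X.coR m = z
    induction z using BT.induction with
    | hm m n => simp
    | h0 => simp
    | ha x y hx hy => rw [map_add, ← hx, ← hy]
  coL m := by
    rw [LinearMap.id_apply]
    generalize X.coL m = z
    induction z using BT.induction with
    | hm m n => simp
    | h0 => simp
    | ha x y hx hy => rw [map_add, ← hx, ← hy]

theorem HComodule.IsHom.comp {X : HComodule 𝓗 M} {X' : HComodule 𝓗 M'} {X'' : HComodule 𝓗 M''}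
    {g : M' →ₗ[k] M''} {f : M →ₗ[k] M'} (hg : X'.IsHom X'' g) (hf : X.IsHom X' f) :
    X.IsHom X'' (g ∘ₗ f) where
  actR r m := by simp [hf.actR, hg.actR]
  actL l m := by simp [hf.actL, hg.actL]
  coR m := by
    rw [LinearMap.comp_apply, hg.coR, hf.coR]
    generalize X.coR m = z
    induction z using BT.induction with
    | hm m n => simp
    | h0 => simp
    | ha x y hx hy => simp only [map_add, hx, hy]
  coL m := by
    rw [LinearMap.comp_apply, hg.coL, hf.coL]
    generalize X.coL m = z
    induction z using BT.induction with
    | hm m n => simp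
    | h0 => simp
    | ha x y hx hy => simp only [map_add, hx, hy]

namespace HopfModule

variable {𝒜 : ComoduleAlgebra 𝓗 A}

instance category : Category (HopfModule.{v} 𝒜) where
  Hom := Hom
  id X := ⟨LinearMap.id, fun _ _ => rfl, .id _⟩
  comp f g := ⟨g.map ∘ₗ f.map, fun a m => by simp [f.map_act, g.map_act], g.isHom.comp f.isHom⟩

@[ext] theorem hom_ext {X Y : HopfModule.{v} 𝒜} {f g : X ⟶ Y} (h : ∀ m, f.map m = g.map m) :
    f = g :=
  Hom.ext (LinearMap.ext h)

@[simp] theorem id_map (X : HopfModule.{v} 𝒜) (m : X.carrier) : Hom.map (𝟙 X) m = m := (rfl)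

@[simp] theorem comp_map {X Y Z : HopfModule.{v} 𝒜} (f : X ⟶ Y) (g : Y ⟶ Z) (m : X.carrier) :
    Hom.map (f ≫ g) m = g.map (f.map m) := (rfl)

end HopfModule

theorem HComodule.IsAction.of_maps {A : Type*} [AddCommGroup A] [Module k A] {X : HComodule 𝓗 M}
    {Z : HComodule 𝓗 A} {mu : M →ₗ[k] A →ₗ[k] M} (h : X.IsAction Z mu) {X' : HComodule 𝓗 M'}
    {mu' : M' →ₗ[k] A →ₗ[k] M'} {ι : Type*} (i : ι → M →ₗ[k] M')
    (hi : ∀ p : M' → Prop, (∀ w m, p (i w m)) → p 0 → (∀ x y, p x → p y → p (x + y)) → ∀ z, p z)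
    (hom : ∀ w, X.IsHom X' (i w)) (hmu : ∀ w m a, mu' (i w m) a = i w (mu m a)) :
    X'.IsAction Z mu' := by
  have h1 : ∀ (r : R) m a,
      mu' (X'.actR (op r) m) a = mu' m (Z.actL (op (𝓗.left.ε (𝓗.right.s r))) a) := by
    intro r z a
    refine hi (fun z => mu' (X'.actR (op r) z) a =
      mu' z (Z.actL (op (𝓗.left.ε (𝓗.right.s r))) a)) ?_ (by simp)
      (fun x y hx hy => by simp only [map_add, LinearMap.add_apply, hx, hy]) z
    intro w m
    rw [← (hom w).actR, hmu, hmu, h.balanced]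
  have h2 : ∀ m (r : Rᵐᵒᵖ) a, mu' m (Z.actR r a) = X'.actR r (mu' m a) := by
    intro z r a
    refine hi (fun z => mu' z (Z.actR r a) = X'.actR r (mu' z a)) ?_ (by simp)
      (fun x y hx hy => by simp only [map_add, LinearMap.add_apply, hx, hy]) z
    intro w m
    rw [hmu, hmu, h.actR, (hom w).actR]
  have h3 : ∀ a (l : Lᵐᵒᵖ) m, mu' (X'.actL l m) a = X'.actL l (mu' m a) := by
    intro a l z
    refine hi (fun z => mu' (X'.actL l z) a = X'.actL l (mu' z a)) ?_ (by simp)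
      (fun x y hx hy => by simp only [map_add, LinearMap.add_apply, hx, hy]) z
    intro w m
    rw [← (hom w).actL, hmu, hmu, h.actL, (hom w).actL]
  refine ⟨h1, h2, h3, fun z a => ?_, fun z a => ?_⟩
  · refine hi (fun z => X'.coR (mu' z a) = BT.lift _ _ (X'.coR z)) ?_ (by simp)
      (fun x y hx hy => by simp only [map_add, LinearMap.add_apply, hx, hy]) z
    intro w m
    rw [hmu, (hom w).coR, (hom w).coR, h.coR]
    generalize X.coR m = u
    induction u using BT.induction with
    | hm x y =>
      rw [BT.lift_mk, BT.map_mk, BT.lift_mk]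
      generalize Z.coR a = v
      induction v using BT.induction with
      | hm m n => simp [hmu]
      | h0 => simp
      | ha x y hx hy => simp only [map_add, LinearMap.add_apply, hx, hy]
    | h0 => simp
    | ha x y hx hy => simp only [map_add, hx, hy]
  · have lin : ∀ (φ : M' →ₗ[k] A →ₗ[k] H →ₗ[k] BT X'.actL 𝓗.lL)
        (hφ : ∀ z (l : L) m n, φ z (Z.actL (op l) m) n = φ z m (𝓗.lL l n))
        (p : ∀ w m, X'.coL (mu' (i w m) a) = BT.lift (φ (i w m)) (hφ (i w m)) (Z.coL a)),
        X'.coL (mu' z a) = BT.lift (φ z) (hφ z) (Z.coL a) := by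
      intro φ hφ p
      have hadd : ∀ x y v, BT.lift (φ (x + y)) (hφ (x + y)) v =
          BT.lift (φ x) (hφ x) v + BT.lift (φ y) (hφ y) v := by
        intro x y v
        induction v using BT.induction with
        | hm m n => simp
        | h0 => simp
        | ha a b ha hb =>
          rw [(BT.lift (φ (x + y)) (hφ (x + y))).map_add, (BT.lift (φ x) (hφ x)).map_add,
            (BT.lift (φ y) (hφ y)).map_add, ha, hb]
          abel
      have hzero : ∀ v, BT.lift (φ 0) (hφ 0) v = 0 := by
        intro v
        induction v using BT.induction with
        | hm m n => simp
        | h0 => simp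
        | ha a b ha hb => simp only [map_add, ha, hb, add_zero]
      refine hi (fun z => X'.coL (mu' z a) = BT.lift (φ z) (hφ z) (Z.coL a)) p
        (by rw [hzero]; simp) (fun x y hx hy => ?_) z
      rw [hadd, ← hx, ← hy]
      simp
    refine lin (BT.bimap mu'.flip (mulFlip k H) (flip_act h3) (mulFlip_lmulL _) ∘ₗ X'.coL)
      (fun z l _ _ => BT.bimap_bal _ _ (flip_act h3) (mulFlip_lmulL _) (X'.takeuchiL l z)
        (fun _ => by simp [h1, 𝓗.ε_s_ε_t]) (fun _ => by simp [mul_assoc])) ?_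
    intro w m
    rw [hmu, (hom w).coL, h.coL]
    generalize Z.coL a = v
    induction v using BT.induction with
    | hm x y =>
      rw [BT.lift_mk, BT.lift_mk, LinearMap.comp_apply, (hom w).coL]
      generalize X.coL m = u
      induction u using BT.induction with
      | hm m n => simp [hmu]
      | h0 => simp
      | ha x y hx hy => simp only [map_add, LinearMap.add_apply, hx, hy]
    | h0 => simp
    | ha x y hx hy => simp only [map_add, hx, hy]

/-! ### The induction functor -/

namespace ComoduleAlgebra

variable (𝒜 : ComoduleAlgebra 𝓗 A) {B : Type*} [Ring B] [Algebra k B]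

theorem actR_coinv {a : A} (ha : a ∈ 𝒜.coinvariants) (l : L) :
    𝒜.com.actL (op l) a = 𝒜.com.actR (op (𝓗.right.ε (𝓗.left.t (op l)))) a := by
  have ha' : 𝒜.com.coR a = BT.mk _ _ a 1 := ha
  rw [← 𝒜.com.isComoduleR.counit (𝒜.com.actL (op l) a), 𝒜.com.coassocRL.right_linear, ha',
    BT.rightAct_mk, BT.contr_mk]
  simp

/-- Left multiplication by a coinvariant is a comodule endomorphism of `A`. -/
theorem mulLeft_isHom {b : A} (hb : b ∈ 𝒜.coinvariants) :
    𝒜.com.IsHom 𝒜.com (LinearMap.mulLeft k b) := by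
  have hb' : 𝒜.com.coR b = BT.mk _ _ b 1 := hb
  have hL := 𝒜.com.coinvL hb'
  have hl : ∀ (l : Lᵐᵒᵖ) m, b * 𝒜.com.actL l m = 𝒜.com.actL l (b * m) := fun l m => by
    have h1 := 𝒜.isAction.balanced (𝓗.right.ε (𝓗.left.t l)) b m
    have h2 := 𝒜.isAction.actL m l b
    have h3 := 𝒜.actR_coinv hb l.unop
    rw [op_unop] at h3
    rw [h3] at h2
    have h4 := 𝓗.ε_s_ε_t l.unop
    rw [op_unop] at h4
    rw [h4, op_unop, h2] at h1
    exact h1.symm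
  refine ⟨fun r m => ?_, fun l m => by simpa using hl l m, fun m => ?_, fun m => ?_⟩
  · simpa using 𝒜.isAction.actR b r m
  · refine (𝒜.isAction.coR b m).trans ?_
    rw [hb', BT.lift_mk]
    generalize 𝒜.com.coR m = z
    induction z using BT.induction with
    | hm m n => simp
    | h0 => simp
    | ha x y hx hy => simp only [map_add, LinearMap.add_apply, hx, hy]
  · refine (𝒜.isAction.coL b m).trans ?_
    generalize 𝒜.com.coL m = z
    induction z using BT.induction with
    | hm m n =>
      rw [BT.lift_mk, hL]
      exact (BT.bimap_mk _ _ _ _ _ _ _ _).trans (by simp)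
    | h0 => simp
    | ha x y hx hy => simp only [map_add, hx, hy]

variable (f : B →ₐ[k] A)

theorem lmulL_actR (hf : ∀ b, f b ∈ 𝒜.coinvariants) (b : B) (r : Rᵐᵒᵖ) (a : A) :
    lmulL f b (𝒜.com.actR r a) = 𝒜.com.actR r (lmulL f b a) := by
  simpa using (𝒜.mulLeft_isHom (hf b)).actR r a

theorem lmulL_actL (hf : ∀ b, f b ∈ 𝒜.coinvariants) (b : B) (l : Lᵐᵒᵖ) (a : A) :
    lmulL f b (𝒜.com.actL l a) = 𝒜.com.actL l (lmulL f b a) := by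
  simpa using (𝒜.mulLeft_isHom (hf b)).actL l a

variable (hf : ∀ b, f b ∈ 𝒜.coinvariants) {W : Type*} [AddCommGroup W] [Module k W]
  (ρ : RAct k B W)

/-- The right `R`-action on `W ⊗_B A`, given by that on the second factor. -/
def indActR : RAct k R (BT ρ (lmulL f)) :=
  BT.rightAct ρ (lmulL f) 𝒜.com.actR (𝒜.lmulL_actR f hf)

/-- The right `L`-action on `W ⊗_B A`, given by that on the second factor. -/
def indActL : RAct k L (BT ρ (lmulL f)) :=
  BT.rightAct ρ (lmulL f) 𝒜.com.actL (𝒜.lmulL_actL f hf)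

theorem indActR_mk (r : Rᵐᵒᵖ) (w : W) (a : A) : 𝒜.indActR f hf ρ r (BT.mk _ _ w a) =
    BT.mk _ _ w (𝒜.com.actR r a) :=
  BT.rightAct_mk _ _ r w a

theorem indActL_mk (r : Lᵐᵒᵖ) (w : W) (a : A) : 𝒜.indActL f hf ρ r (BT.mk _ _ w a) =
    BT.mk _ _ w (𝒜.com.actL r a) :=
  BT.rightAct_mk _ _ r w a

/-- The coaction `w ⊗ a ↦ (w ⊗ a⁰) ⊗_R a¹`. -/
def indCoR : BT ρ (lmulL f) →ₗ[k] BT (𝒜.indActR f hf ρ) 𝓗.lR :=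
  BT.lift ((BT.mapL (BT.mk ρ (lmulL f)) (fun w r a => (𝒜.indActR_mk f hf ρ r w a).symm) ∘ₗ
      𝒜.com.coR).flip) (fun b w a => by
    have h := (𝒜.mulLeft_isHom (hf b)).coR a
    rw [LinearMap.mulLeft_apply] at h
    simp only [LinearMap.flip_apply, LinearMap.comp_apply, lmulL_apply, h]
    generalize 𝒜.com.coR a = z
    induction z using BT.induction with
    | hm m n => simp [BT.mk_bal]
    | h0 => simp
    | ha x y hx hy => simp only [map_add, LinearMap.add_apply, hx, hy])

/-- The coaction `w ⊗ a ↦ (w ⊗ a₀) ⊗_L a₁`. -/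
def indCoL : BT ρ (lmulL f) →ₗ[k] BT (𝒜.indActL f hf ρ) 𝓗.lL :=
  BT.lift ((BT.mapL (BT.mk ρ (lmulL f)) (fun w r a => (𝒜.indActL_mk f hf ρ r w a).symm) ∘ₗ
      𝒜.com.coL).flip) (fun b w a => by
    have h := (𝒜.mulLeft_isHom (hf b)).coL a
    rw [LinearMap.mulLeft_apply] at h
    simp only [LinearMap.flip_apply, LinearMap.comp_apply, lmulL_apply, h]
    generalize 𝒜.com.coL a = z
    induction z using BT.induction with
    | hm m n => simp [BT.mk_bal]
    | h0 => simp
    | ha x y hx hy => simp only [map_add, LinearMap.add_apply, hx, hy])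

theorem indCoR_mk (w : W) (a : A) : 𝒜.indCoR f hf ρ (BT.mk _ _ w a) =
    BT.map (BT.mk ρ (lmulL f) w) LinearMap.id (fun r a => (𝒜.indActR_mk f hf ρ r w a).symm)
      (fun _ _ => rfl) (𝒜.com.coR a) := by
  simp [indCoR]

theorem indCoL_mk (w : W) (a : A) : 𝒜.indCoL f hf ρ (BT.mk _ _ w a) =
    BT.map (BT.mk ρ (lmulL f) w) LinearMap.id (fun r a => (𝒜.indActL_mk f hf ρ r w a).symm)
      (fun _ _ => rfl) (𝒜.com.coL a) := by
  simp [indCoL]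

/-- The comodule `W ⊗_B A`, with the actions and coactions of the second factor, for a right
`B`-module `W` and an algebra map `f` from `B` to the coinvariants of `A`. -/
def inducedComodule : HComodule 𝓗 (BT ρ (lmulL f)) where
  actR := 𝒜.indActR f hf ρ
  actL := 𝒜.indActL f hf ρ
  coR := 𝒜.indCoR f hf ρ
  coL := 𝒜.indCoL f hf ρ
  isComoduleR := 𝒜.com.isComoduleR.of_maps (BT.mk ρ (lmulL f))
    (fun _ h h0 ha z => BT.induction z h h0 ha) _ (𝒜.indCoR_mk f hf ρ)
  isComoduleL := 𝒜.com.isComoduleL.of_maps (BT.mk ρ (lmulL f))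
    (fun _ h h0 ha z => BT.induction z h h0 ha) _ (𝒜.indCoL_mk f hf ρ)
  coassocRL := 𝒜.com.coassocRL.of_maps (BT.mk ρ (lmulL f))
    (fun _ h h0 ha z => BT.induction z h h0 ha) _ _ (𝒜.indCoR_mk f hf ρ) (𝒜.indCoL_mk f hf ρ)
  coassocLR := 𝒜.com.coassocLR.of_maps (BT.mk ρ (lmulL f))
    (fun _ h h0 ha z => BT.induction z h h0 ha) _ _ (𝒜.indCoL_mk f hf ρ) (𝒜.indCoR_mk f hf ρ)

/-- The right `A`-action `(w ⊗ a) a' = w ⊗ a a'` on `W ⊗_B A`. -/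
def inducedAct : RAct k A (BT ρ (lmulL f)) :=
  BT.rightAct ρ (lmulL f) (rmulR (AlgHom.id k A)) (lmulL_rmulR_comm f (AlgHom.id k A))

theorem inducedAct_mk (w : W) (a a' : A) :
    inducedAct f ρ (op a') (BT.mk _ _ w a) = BT.mk _ _ w (a * a') :=
  BT.rightAct_mk _ _ (op a') w a

theorem mk_isHom (w : W) :
    𝒜.com.IsHom (𝒜.inducedComodule f hf ρ) (BT.mk ρ (lmulL f) w) :=
  ⟨fun r a => (𝒜.indActR_mk f hf ρ r w a).symm, fun l a => (𝒜.indActL_mk f hf ρ l w a).symm,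
    𝒜.indCoR_mk f hf ρ w, 𝒜.indCoL_mk f hf ρ w⟩

theorem induced_isAction :
    (𝒜.inducedComodule f hf ρ).IsAction 𝒜.com (inducedAct f ρ).bil :=
  𝒜.isAction.of_maps (BT.mk ρ (lmulL f)) (fun _ h h0 ha z => BT.induction z h h0 ha)
    (𝒜.mk_isHom f hf ρ) (fun w a a' => inducedAct_mk f ρ w a a')

/-- Scalars of `k` on a right module over the `k`-algebra `B`. -/
@[reducible] def moduleCatModule (W : ModuleCat.{v} Bᵐᵒᵖ) : Module k W :=
  Module.restrictScalars k Bᵐᵒᵖ W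

attribute [local instance] moduleCatModule

/-- The right `B`-module `W` as an explicit action. -/
def modAct (W : ModuleCat.{v} Bᵐᵒᵖ) : RAct k B W :=
  haveI : IsScalarTower k Bᵐᵒᵖ W := IsScalarTower.restrictScalars k Bᵐᵒᵖ W
  Algebra.lsmul k k W

theorem modAct_apply (W : ModuleCat.{v} Bᵐᵒᵖ) (b : Bᵐᵒᵖ) (w : W) :
    modAct (k := k) W b w = b • w := (rfl)

/-- The `k`-linear map underlying a map of right `B`-modules. -/
def modMap {W W' : ModuleCat.{v} Bᵐᵒᵖ} (g : W ⟶ W') : W →ₗ[k] W' where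
  toFun := g
  map_add' := map_add g.hom
  map_smul' c w := g.hom.map_smul (algebraMap k Bᵐᵒᵖ c) w

theorem modMap_apply {W W' : ModuleCat.{v} Bᵐᵒᵖ} (g : W ⟶ W') (w : W) :
    modMap (k := k) g w = g w := (rfl)

theorem modMap_act {W W' : ModuleCat.{v} Bᵐᵒᵖ} (g : W ⟶ W') (b : Bᵐᵒᵖ) (w : W) :
    modMap (k := k) g (modAct (k := k) W b w) = modAct (k := k) W' b (modMap (k := k) g w) :=
  g.hom.map_smul b w

/-- The map `g ⊗_B A`. -/
def indMap {W W' : ModuleCat.{v} Bᵐᵒᵖ} (g : W ⟶ W') :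
    BT (modAct (k := k) W) (lmulL f) →ₗ[k] BT (modAct (k := k) W') (lmulL f) :=
  BT.map (modMap g) LinearMap.id (modMap_act g) (fun _ _ => rfl)

theorem indMap_mk {W W' : ModuleCat.{v} Bᵐᵒᵖ} (g : W ⟶ W') (w : W) (a : A) :
    indMap f g (BT.mk _ _ w a) = BT.mk _ _ (modMap (k := k) g w) a :=
  BT.map_mk _ _ _ _ w a

theorem indMap_isHom {W W' : ModuleCat.{v} Bᵐᵒᵖ} (g : W ⟶ W') :
    (𝒜.inducedComodule f hf (modAct W)).IsHom (𝒜.inducedComodule f hf (modAct W'))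
      (indMap f g) := by
  have h := fun w => 𝒜.mk_isHom f hf (modAct (k := k) W) w
  have h' := fun w => 𝒜.mk_isHom f hf (modAct (k := k) W') w
  refine ⟨fun r z => ?_, fun l z => ?_, fun z => ?_, fun z => ?_⟩
  · induction z using BT.induction with
    | hm w a => rw [← (h w).actR, indMap_mk, indMap_mk, ← (h' _).actR]
    | h0 => simp
    | ha x y hx hy => simp only [map_add, hx, hy]
  · induction z using BT.induction with
    | hm w a => rw [← (h w).actL, indMap_mk, indMap_mk, ← (h' _).actL]
    | h0 => simp
    | ha x y hx hy => simp only [map_add, hx, hy]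
  · induction z using BT.induction with
    | hm w a =>
      rw [indMap_mk, (h w).coR, (h' _).coR]
      generalize 𝒜.com.coR a = v
      induction v using BT.induction with
      | hm m n => simp [indMap_mk]
      | h0 => simp
      | ha x y hx hy => simp only [map_add, hx, hy]
    | h0 => simp
    | ha x y hx hy => simp only [map_add, hx, hy]
  · induction z using BT.induction with
    | hm w a =>
      rw [indMap_mk, (h w).coL, (h' _).coL]
      generalize 𝒜.com.coL a = v
      induction v using BT.induction with
      | hm m n => simp [indMap_mk]
      | h0 => simp
      | ha x y hx hy => simp only [map_add, hx, hy]
    | h0 => simp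
    | ha x y hx hy => simp only [map_add, hx, hy]

/-- The functor `- ⊗_B A` from right `B`-modules to Hopf modules, for an algebra map `f` from `B` to
the coinvariants of `A`. -/
def inducedFunctor : ModuleCat.{max v u₅} Bᵐᵒᵖ ⥤ HopfModule.{max v u₅} 𝒜 where
  obj W :=
    { carrier := BT (modAct (k := k) W) (lmulL f)
      com := 𝒜.inducedComodule f hf (modAct W)
      act := inducedAct f (modAct W)
      isAction := 𝒜.induced_isAction f hf (modAct W) }
  map {W W'} g :=
    { map := indMap f g
      map_act := fun a z => by
        induction z using BT.induction with
        | hm w x =>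
          induction a
          rw [inducedAct_mk, indMap_mk, indMap_mk, inducedAct_mk]
        | h0 => simp
        | ha x y hx hy => simp only [map_add, hx, hy]
      isHom := 𝒜.indMap_isHom f hf g }
  map_id W := HopfModule.Hom.ext (BT.hom_ext fun w a => indMap_mk f (𝟙 W) w a)
  map_comp {W W' W''} g g' := HopfModule.Hom.ext (BT.hom_ext fun w a => by
    refine (indMap_mk f (g ≫ g') w a).trans (Eq.symm ?_)
    refine (congrArg (indMap f g') (indMap_mk f g w a)).trans ?_
    rw [indMap_mk]
    rfl)

/-- The functor `- ⊗_T A : M_T → M^𝓗_A`, where `T` is the algebra of coinvariants of `A`. -/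
def tensorFunctor : ModuleCat.{max v u₅} 𝒜.coinvariantsᵐᵒᵖ ⥤ HopfModule.{max v u₅} 𝒜 :=
  𝒜.inducedFunctor 𝒜.coinvariants.val (fun t => t.2)

end ComoduleAlgebra

theorem HopfAlgebroid.s_left_mem (𝓗 : HopfAlgebroid k L R H) (l : L) :
    𝓗.left.s l ∈ 𝓗.regular.coinvariants := by
  have h := 𝓗.coassoc_left_right.left_linear l 1
  rw [𝓗.right.Δ_one, BT.leftAct_mk, lmulL_apply, mul_one] at h
  exact h

/-- The functor `- ⊗_L H : M_L → M^𝓗_H`, where `H` is a left `L`-module by `l h = s_L(l) h`. -/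
def HopfAlgebroid.tensorFunctor (𝓗 : HopfAlgebroid k L R H) :
    ModuleCat.{max v u₄} Lᵐᵒᵖ ⥤ HopfModule.{max v u₄} 𝓗.regular :=
  𝓗.regular.inducedFunctor 𝓗.left.s 𝓗.s_left_mem

end HopfModule

end HopfAlgd

/-! The central object is the map E(m) = m⁰ j'(m¹) on a Hopf module M. Maps out of M can be
convolved with j along the L-coaction, Φ ↦ Φ(m₀) j(m₁), and with j' along the R-coaction, Φ ↦ Φ(m⁰)
j'(m¹). Mixed coassociativity of the two coactions turns a double convolution into one with the
product of j and j' in H, which is a counit; hence the two operations undo each other on suitably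
linear maps (`Coassoc.convolution_inverse`). Since E is the convolution of the identity with j',
this gives m = E(m₀) j(m₁) (`proj_convolution`).

The crucial point is that E(m) is coinvariant (`coR_proj`). Let A act diagonally on M ⊗_R H, and
compare the maps m ↦ E(m)⁰ ⊗ E(m)¹ and m ↦ E(m) ⊗ 1. Convolved with j, both give the R-coaction of
M: the first because the coaction is A-linear, the second because j is colinear. Convolving with j'
recovers each of them from the same map, so they agree. Only balanced maps are evaluated on the
coassociativity identities; no equalizer has to be preserved by a tensor product, so purity plays no
role.

The rest follows from naturality of E, which gives E(na) = n E(a) for n coinvariant and E(w ⊗ a) = w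
⊗ E(a). The map n ⊗ a ↦ na from M^co ⊗_T A to M has inverse m ↦ E(m₀) ⊗ j(m₁). In the other
direction, a ↦ E(a) j(1) is a left T-linear retraction of A onto T, and it forces every coinvariant
of W ⊗_T A to be of the form w ⊗ 1. This makes the functor fully faithful and essentially
surjective.

All this is done for an algebra map f : B → A that is an isomorphism onto the coinvariants. The
inclusion of T gives the first assertion. For the second, H is cleft with j = id and j' = S, and s_L
is an isomorphism of L onto its coinvariants. -/

namespace HopfAlgd

/-! ### Convolution along coassociative pairs of coactions -/

section Convolution

variable {k : Type*} [CommRing k] {B : Type*} [Ring B] [Algebra k B]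
  {C : Type*} [Ring C] [Algebra k C]
  {M : Type*} [AddCommGroup M] [Module k M] {N : Type*} [AddCommGroup N] [Module k N]
  {P : Type*} [AddCommGroup P] [Module k P] {V : Type*} [AddCommGroup V] [Module k V]

/-- Evaluating a balanced trilinear map on both sides of the coassociativity relation. -/
theorem Coassoc.lift_eq {rB : RAct k B M} {rC : RAct k C M} {lN : LAct k B N} {rN : RAct k C N}
    {lP : LAct k C P} {comm : ∀ b (c : Cᵐᵒᵖ) n, lN b (rN c n) = rN c (lN b n)}
    {coB : M →ₗ[k] BT rB lN} {coC : M →ₗ[k] BT rC lP} {Δ : N →ₗ[k] BT rN lP}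
    (h : Coassoc rB rC lN rN lP comm coB coC Δ) (F : M →ₗ[k] N →ₗ[k] P →ₗ[k] V)
    (hB : ∀ b m n p, F (rB (op b) m) n p = F m (lN b n) p)
    (hC : ∀ m c n p, F m (rN (op c) n) p = F m n (lP c p))
    (g₁ : M →ₗ[k] P →ₗ[k] V) (b₁ : ∀ c m p, g₁ (rC (op c) m) p = g₁ m (lP c p))
    (h₁ : ∀ m p, g₁ m p = BT.lift (F.compr₂ (LinearMap.applyₗ p))
      (fun b m n => hB b m n p) (coB m))
    (g₂ : M →ₗ[k] N →ₗ[k] V) (b₂ : ∀ b m n, g₂ (rB (op b) m) n = g₂ m (lN b n))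
    (h₂ : ∀ m n, g₂ m n = BT.lift (F m) (hC m) (Δ n)) (m : M) :
    BT.lift g₁ b₁ (coC m) = BT.lift g₂ b₂ (coB m) := by
  let T : M →ₗ[k] BT rN lP →ₗ[k] V :=
    { toFun := fun m => BT.lift (F m) (hC m)
      map_add' := fun _ _ => BT.hom_ext fun _ _ => by simp
      map_smul' := fun _ _ => BT.hom_ext fun _ _ => by simp }
  have hT : ∀ m n p, T m (BT.mk rN lP n p) = F m n p := fun m n p => BT.lift_mk (F m) (hC m) n p
  -- `U` is the linear map on M ⊗_B (N ⊗_C P) induced by `F`; it is applied to both sides of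
  -- coassociativity.
  let U : BT rB (BT.leftAct rN lP lN comm) →ₗ[k] V := BT.lift T (fun b m z => by
    induction z using BT.induction with
    | hm n p => rw [BT.leftAct_mk, hT, hT, hB]
    | h0 => simp
    | ha x y hx hy => simp only [map_add, hx, hy])
  have hU : ∀ m z, U (BT.mk _ _ m z) = T m z := fun m z => BT.lift_mk _ _ m z
  have key := congrArg U (h.coassoc m)
  have hR : ∀ z, U (BT.map LinearMap.id Δ (fun _ _ => rfl) h.left_linear z) =
      BT.lift g₂ b₂ z := fun z => by
    induction z using BT.induction with
    | hm m n => rw [BT.map_mk, hU, BT.lift_mk, h₂]; rfl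
    | h0 => simp
    | ha x y hx hy => simp only [map_add, hx, hy]
  have hL0 : ∀ y p, U (BT.insert rB lN rN lP comm y p) =
      BT.lift (F.compr₂ (LinearMap.applyₗ p)) (fun b m n => hB b m n p) y := fun y p => by
    induction y using BT.induction with
    | hm m n =>
      rw [BT.insert_mk, hU, hT]
      exact (BT.lift_mk (F.compr₂ (LinearMap.applyₗ p)) (fun b m n => hB b m n p) m n).symm
    | h0 => simp
    | ha x y hx hy => simp only [map_add, LinearMap.add_apply, hx, hy]
  have hL : ∀ z, U (BT.assoc rB lN rN lP comm
      (BT.map coB LinearMap.id h.right_linear (fun _ _ => rfl) z)) = BT.lift g₁ b₁ z := fun z => by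
    induction z using BT.induction with
    | hm m p => rw [BT.map_mk, BT.assoc_mk, LinearMap.id_apply, hL0, BT.lift_mk, h₁]
    | h0 => simp
    | ha x y hx hy => simp only [map_add, hx, hy]
  rw [hL, hR] at key
  exact key

/-- If `φ` and `χ` are convolution inverses and `Θ` is the convolution product of `Φ` and `φ`, then
the convolution product of `Θ` and `χ` is `Φ`. -/
theorem Coassoc.convolution_inverse {A : Type*} [Ring A] [Algebra k A]
    {rB : RAct k B M} {rC : RAct k C M} {lN : LAct k B N} {rN : RAct k C N}
    {lP : LAct k C P} {comm : ∀ b (c : Cᵐᵒᵖ) n, lN b (rN c n) = rN c (lN b n)}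
    {coB : M →ₗ[k] BT rB lN} {coC : M →ₗ[k] BT rC lP} {Δ : N →ₗ[k] BT rN lP}
    (h : Coassoc rB rC lN rN lP comm coB coC Δ) {ε : N →ₗ[k] B}
    {hε : ∀ b n, ε (lN b n) = b * ε n} (counit : ∀ m, BT.contr rB lN ε hε (coB m) = m)
    (β : V →ₗ[k] A →ₗ[k] V) (hβ : ∀ v a b, β (β v a) b = β v (a * b)) (η : B →ₐ[k] A)
    (Φ : M →ₗ[k] V) (hΦ : ∀ b m, Φ (rB (op b) m) = β (Φ m) (η b))
    (φ : N →ₗ[k] A) (hφ : ∀ b n, φ (lN b n) = η b * φ n) (χ : P →ₗ[k] A)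
    (hφχ : ∀ c n p, (LinearMap.mul k A).compl₁₂ φ χ (rN (op c) n) p =
      (LinearMap.mul k A).compl₁₂ φ χ n (lP c p))
    (inv : ∀ n, BT.lift ((LinearMap.mul k A).compl₁₂ φ χ) hφχ (Δ n) = η (ε n))
    (Θ : M →ₗ[k] V) (bΘ : ∀ b m n, β.compl₁₂ Φ φ (rB (op b) m) n = β.compl₁₂ Φ φ m (lN b n))
    (hΘ : ∀ m, Θ m = BT.lift (β.compl₁₂ Φ φ) bΘ (coB m))
    (bχ : ∀ c m p, β.compl₁₂ Θ χ (rC (op c) m) p = β.compl₁₂ Θ χ m (lP c p)) (m : M) :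
    BT.lift (β.compl₁₂ Θ χ) bχ (coC m) = Φ m := by
  -- The trilinear map is (m, n, p) ↦ Φ(m) φ(n) χ(p). Contracting its first two arguments along
  -- `coB` gives Θ(m) χ(p); contracting the last two along `Δ` gives Φ(m) η(ε(n)).
  rw [h.lift_eq ((β.compl₁₂ Φ φ).compr₂ (β.compl₂ χ)) (fun b m n p => by simp [hΦ, hβ, hφ])
    (fun m c n p => by
      have := hφχ c n p
      simp only [LinearMap.compl₁₂_apply, LinearMap.mul_apply'] at this
      simp [hβ, this])
    (β.compl₁₂ Θ χ) bχ (fun m p => ?_) (β.compl₁₂ Φ (η.toLinearMap ∘ₗ ε))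
    (fun b m n => by simp [hΦ, hβ, hε]) (fun m n => ?_) m]
  -- What remains is Φ(m₀) η(ε(m₁)) = Φ(m₀ ε(m₁)) = Φ(m).
  · conv_rhs => rw [← counit m]
    generalize coB m = z
    induction z using BT.induction with
    | hm m n => simp [hΦ]
    | h0 => simp
    | ha x y hx hy => simp only [map_add, hx, hy]
  · rw [LinearMap.compl₁₂_apply, hΘ]
    generalize coB m = z
    induction z using BT.induction with
    | hm m n =>
      refine Eq.trans ?_ (BT.lift_mk _ _ m n).symm
      simp
    | h0 => simp
    | ha x y hx hy => simp only [map_add, LinearMap.add_apply, hx, hy]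
  · rw [LinearMap.compl₁₂_apply, LinearMap.comp_apply, AlgHom.toLinearMap_apply, ← inv]
    generalize Δ n = z
    induction z using BT.induction with
    | hm m n => simp [hβ]
    | h0 => simp
    | ha x y hx hy => simp only [map_add, hx, hy]

end Convolution

section Projection

variable {k : Type*} [CommRing k] {L : Type*} [Ring L] [Algebra k L] {R : Type*} [Ring R]
  [Algebra k R] {H : Type*} [Ring H] [Algebra k H] {𝓗 : HopfAlgebroid k L R H}
  {A : Type*} [Ring A] [Algebra k A] {𝒜 : ComoduleAlgebra 𝓗 A}
  {M : Type*} [AddCommGroup M] [Module k M] {M' : Type*} [AddCommGroup M'] [Module k M']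

/-! ### Coinvariant elements and the diagonal action on M ⊗_R H -/

namespace HComodule

/-- The R-coaction sends m l to m⁰ ⊗ t_L(l) m¹ = m ⊗ t_L(l); now apply the counit. On coinvariants
the L-action is thus determined by the R-action. -/
theorem actL_of_coinv (X : HComodule 𝓗 M) {m : M} (hm : X.coR m = BT.mk _ _ m 1) (l : Lᵐᵒᵖ) :
    X.actL l m = X.actR (op (𝓗.right.ε (𝓗.left.t l))) m := by
  rw [← X.isComoduleR.counit (X.actL l m), X.coassocRL.right_linear, hm,
    BT.rightAct_mk, BT.contr_mk]
  simp

namespace IsAction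

variable {X : HComodule 𝓗 M} {mu : M →ₗ[k] A →ₗ[k] M}

/-- Acting on a coinvariant element is a comodule map. -/
theorem isHom_of_coinv (h : X.IsAction 𝒜.com mu) {n : M} (hn : X.coR n = BT.mk _ _ n 1) :
    𝒜.com.IsHom X (mu n) where
  actR r a := h.actR n r a
  actL l a := by
    -- For r = ε_R(t_L(l)) one has n r = n l because n is coinvariant, and ε_L(s_R(r)) = l.
    -- Balancedness over R then reads (n l) a = n (a l).
    have h1 := h.balanced (𝓗.right.ε (𝓗.left.t l)) n a
    rw [← X.actL_of_coinv hn, h.actL] at h1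
    have h4 := 𝓗.ε_s_ε_t l.unop
    rw [op_unop] at h4
    rw [h4, op_unop] at h1
    exact h1.symm
  coR a := by
    refine (h.coR n a).trans ?_
    rw [hn, BT.lift_mk]
    generalize 𝒜.com.coR a = z
    induction z using BT.induction with
    | hm m n => simp
    | h0 => simp
    | ha x y hx hy => simp only [map_add, LinearMap.add_apply, hx, hy]
  coL a := by
    refine (h.coL n a).trans ?_
    have hL := X.coinvL hn
    generalize 𝒜.com.coL a = z
    induction z using BT.induction with
    | hm m n =>
      rw [BT.lift_mk, hL]
      exact (BT.bimap_mk _ _ _ _ _ _ _ _).trans (by simp)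
    | h0 => simp
    | ha x y hx hy => simp only [map_add, hx, hy]

/-- Colinearity of a ↦ n a carries coinvariants of A to coinvariants of M. This is what makes M^co a
right module over T. -/
theorem coinv_act (h : X.IsAction 𝒜.com mu) {n : M} (hn : X.coR n = BT.mk _ _ n 1) {a : A}
    (ha : a ∈ 𝒜.coinvariants) : X.coR (mu n a) = BT.mk _ _ (mu n a) 1 := by
  have ha' : 𝒜.com.coR a = BT.mk _ _ a 1 := ha
  rw [(h.isHom_of_coinv hn).coR, ha', BT.map_mk]
  rfl

theorem act_η (h : X.IsAction 𝒜.com mu) (r : R) (m : M) (a : A) :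
    mu (X.actR (op r) m) a = mu m (𝒜.η r * a) := by
  rw [h.balanced, 𝒜.actL_eq]

/-- The Takeuchi-type identity for the R-coaction of A, taken at l = ε_L(s_R(r)), moves r across; it
applies because ε_R(t_L(l)) = r. -/
theorem diag_balanced (h : X.IsAction 𝒜.com mu) (a : A) (r : R) (m : M) (x : H) :
    BT.bimap mu (LinearMap.mul k H) h.actR (mul_rmulL _) (𝒜.com.coR a) (X.actR (op r) m) x =
      BT.bimap mu (LinearMap.mul k H) h.actR (mul_rmulL _) (𝒜.com.coR a) m (𝓗.lR r x) :=
  BT.bimap_bal _ _ _ _ (𝒜.com.takeuchiR (𝓗.left.ε (𝓗.right.s r)) a)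
    (h.balanced r m) (fun _ => by simp [mul_assoc, 𝓗.ε_t_ε_s])

/-- The diagonal right `A`-action `(m ⊗ h) a = m a⁰ ⊗ h a¹` on `M ⊗_R H`. -/
def diag (h : X.IsAction 𝒜.com mu) : BT X.actR 𝓗.lR →ₗ[k] A →ₗ[k] BT X.actR 𝓗.lR :=
  LinearMap.flip
    { toFun := fun a => BT.lift
        (BT.bimap mu (LinearMap.mul k H) h.actR (mul_rmulL _) (𝒜.com.coR a))
        (h.diag_balanced a)
      map_add' := fun _ _ => BT.hom_ext fun _ _ => by simp
      map_smul' := fun _ _ => BT.hom_ext fun _ _ => by simp }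

theorem diag_mk (h : X.IsAction 𝒜.com mu) (m : M) (x : H) (a : A) :
    h.diag (BT.mk _ _ m x) a =
      BT.bimap mu (LinearMap.mul k H) h.actR (mul_rmulL _) (𝒜.com.coR a) m x :=
  BT.lift_mk _ (h.diag_balanced a) m x

/-- Compatibility of the action with the coaction, read as A-linearity of the R-coaction into M ⊗_R
H. -/
theorem diag_coR (h : X.IsAction 𝒜.com mu) (m : M) (a : A) :
    h.diag (X.coR m) a = X.coR (mu m a) :=
  (h.coR m a).symm

/-- The R-coaction of A is multiplicative and both actions are associative. Hence M ⊗_R H can serve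
as the target of convolutions. -/
theorem diag_diag (h : X.IsAction 𝒜.com mu) (assoc : ∀ m a b, mu (mu m a) b = mu m (a * b))
    (z : BT X.actR 𝓗.lR) (a b : A) : h.diag (h.diag z a) b = h.diag z (a * b) := by
  induction z using BT.induction with
  | hm m x =>
    rw [diag_mk, diag_mk]
    have e := 𝒜.isAction.coR a b
    rw [LinearMap.mul_apply'] at e
    rw [e]
    generalize 𝒜.com.coR a = u
    induction u using BT.induction with
    | hm p q =>
      rw [BT.bimap_mk, diag_mk, BT.lift_mk]
      generalize 𝒜.com.coR b = w
      induction w using BT.induction with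
      | hm c d => simp [assoc, mul_assoc]
      | h0 => simp
      | ha x y hx hy => simp only [map_add, LinearMap.add_apply, hx, hy]
    | h0 => simp
    | ha x y hx hy => simp only [map_add, LinearMap.add_apply, hx, hy]
  | h0 => simp
  | ha x y hx hy => simp only [map_add, LinearMap.add_apply, hx, hy]

theorem diag_mk_one (h : X.IsAction 𝒜.com mu) (m : M) (a : A) :
    h.diag (BT.mk _ _ m 1) a =
      BT.map (mu m) LinearMap.id (h.actR m) (fun _ _ => rfl) (𝒜.com.coR a) := by
  rw [diag_mk]
  generalize 𝒜.com.coR a = u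
  induction u using BT.induction with
  | hm p q => simp
  | h0 => simp
  | ha x y hx hy => simp only [map_add, LinearMap.add_apply, hx, hy]

end IsAction

end HComodule

/-! ### The projection of a Hopf module onto its coinvariants -/

namespace ComoduleAlgebra.Cleaving

open HComodule

variable (𝒞 : 𝒜.Cleaving) {X : HComodule 𝓗 M} {mu : M →ₗ[k] A →ₗ[k] M}

theorem j_rR (r : Rᵐᵒᵖ) (h : H) : 𝒞.j (𝓗.rR r h) = 𝒜.com.actR r (𝒞.j h) :=
  𝒞.j_hom.actR r h

theorem j_actR (r : R) (h : H) : 𝒞.j (𝓗.rR (op r) h) = 𝒞.j h * 𝒜.η r := by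
  rw [𝒞.j_rR, 𝒜.actR_eq]

theorem coR_j (h : H) : 𝒜.com.coR (𝒞.j h) = BT.map (ρ := 𝓗.rR) (σ := 𝓗.lR) 𝒞.j LinearMap.id
    𝒞.j_rR (fun _ _ => rfl) (𝓗.right.Δ h) :=
  𝒞.j_hom.coR h

/-- The projection `m ↦ m⁰ j'(m¹)` of a Hopf module onto its coinvariants. -/
def proj (h : X.IsAction 𝒜.com mu) : M →ₗ[k] M :=
  BT.lift (mu.compl₂ 𝒞.j') (fun r m x => by
    simp [h.act_η, 𝒞.j'_left]) ∘ₗ X.coR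

theorem proj_apply (h : X.IsAction 𝒜.com mu) (m : M) :
    𝒞.proj h m = BT.lift (mu.compl₁₂ LinearMap.id 𝒞.j') (fun r m x => by
      simp [h.act_η, 𝒞.j'_left]) (X.coR m) := (rfl)

/-- The R-coaction of m l is m⁰ ⊗ t_L(l) m¹, and j' turns left multiplication by t_L(l) into right
multiplication by η_L(l). This makes E(m₀) j(m₁) well defined over L. -/
theorem proj_actL (h : X.IsAction 𝒜.com mu) (assoc : ∀ m a b, mu (mu m a) b = mu m (a * b))
    (l : L) (m : M) : 𝒞.proj h (X.actL (op l) m) = mu (𝒞.proj h m) (𝒞.ηL l) := by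
  rw [proj_apply, proj_apply, X.coassocRL.right_linear]
  generalize X.coR m = z
  induction z using BT.induction with
  | hm m n => simp [assoc, 𝒞.j'_right]
  | h0 => simp
  | ha x y hx hy => simp only [map_add, LinearMap.add_apply, hx, hy]

theorem proj_balanced (h : X.IsAction 𝒜.com mu)
    (assoc : ∀ m a b, mu (mu m a) b = mu m (a * b)) (l : L) (m : M) (x : H) :
    mu.compl₁₂ (𝒞.proj h) 𝒞.j (X.actL (op l) m) x =
      mu.compl₁₂ (𝒞.proj h) 𝒞.j m (𝓗.lL l x) := by
  simp [𝒞.proj_actL h assoc, assoc, 𝒞.j_left]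

/-- `E(m₀) j(m₁) = m` for the projection `E` onto the coinvariants. -/
theorem proj_convolution (h : X.IsAction 𝒜.com mu)
    (assoc : ∀ m a b, mu (mu m a) b = mu m (a * b)) (one : ∀ m, mu m 1 = m) (m : M) :
    BT.lift (mu.compl₁₂ (𝒞.proj h) 𝒞.j) (𝒞.proj_balanced h assoc) (X.coL m) = m :=
  -- E is the convolution of the identity with j', and convolving further with j undoes it.
  X.coassocRL.convolution_inverse X.isComoduleR.counit mu assoc 𝒜.η LinearMap.id
    (fun b m => by
      have := h.act_η b m 1
      simpa [one] using this)
    𝒞.j' (fun b n => by simpa using 𝒞.j'_left b n) 𝒞.j _ 𝒞.j'_mul_j (𝒞.proj h) _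
    (𝒞.proj_apply h) _ m

/-- The elements `m⁰ j'(m¹)` are coinvariant. -/
theorem coR_proj (h : X.IsAction 𝒜.com mu)
    (assoc : ∀ m a b, mu (mu m a) b = mu m (a * b)) (one : ∀ m, mu m 1 = m) (m : M) :
    X.coR (𝒞.proj h m) = BT.mk _ _ (𝒞.proj h m) 1 := by
  -- `F` and `G` are the two sides of the claim as functions of m. Each is shown to have the
  -- R-coaction as its convolution with j, and j is convolution invertible.
  let F : M →ₗ[k] BT X.actR 𝓗.lR := X.coR ∘ₗ 𝒞.proj h
  let G : M →ₗ[k] BT X.actR 𝓗.lR := (BT.mk X.actR 𝓗.lR).flip 1 ∘ₗ 𝒞.proj h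
  have hF : ∀ l m, F (X.actL (op l) m) = h.diag (F m) (𝒞.ηL l) := fun l m => by
    simp only [F, LinearMap.comp_apply]
    rw [h.diag_coR, 𝒞.proj_actL h assoc]
  have hG : ∀ l m, G (X.actL (op l) m) = h.diag (G m) (𝒞.ηL l) := fun l m => by
    have hl : 𝒜.com.coR (𝒞.ηL l) = BT.mk _ _ (𝒞.ηL l) 1 := 𝒞.ηL_mem l
    simp only [G, LinearMap.comp_apply, LinearMap.flip_apply]
    rw [h.diag_mk_one, hl, BT.map_mk, 𝒞.proj_actL h assoc]
    rfl
  have bal : ∀ Φ : M →ₗ[k] BT X.actR 𝓗.lR,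
      (∀ l m, Φ (X.actL (op l) m) = h.diag (Φ m) (𝒞.ηL l)) →
      ∀ l m x, h.diag.compl₁₂ Φ 𝒞.j (X.actL (op l) m) x =
        h.diag.compl₁₂ Φ 𝒞.j m (𝓗.lL l x) := fun Φ hΦ l m x => by
    simp [hΦ, h.diag_diag assoc, 𝒞.j_left]
  have bal' : ∀ r m x, h.diag.compl₁₂ X.coR 𝒞.j' (X.actR (op r) m) x =
      h.diag.compl₁₂ X.coR 𝒞.j' m (𝓗.lR r x) := fun r m x => by
    simp [h.diag_coR, h.act_η, 𝒞.j'_left]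
  -- Apply the R-coaction, which is linear for the diagonal action, to m = E(m₀) j(m₁).
  have cF : ∀ m, X.coR m = BT.lift (h.diag.compl₁₂ F 𝒞.j) (bal F hF) (X.coL m) := fun m => by
    conv_lhs => rw [← 𝒞.proj_convolution h assoc one m]
    generalize X.coL m = z
    induction z using BT.induction with
    | hm m n => simp [F, h.diag_coR]
    | h0 => simp
    | ha x y hx hy => simp only [map_add, hx, hy]
  have cG : ∀ m, X.coR m = BT.lift (h.diag.compl₁₂ G 𝒞.j) (bal G hG) (X.coL m) := fun m => by
    -- The trilinear map is (m, n, p) ↦ E(m) j(n) ⊗ p. As j is colinear, contraction along Δ_R gives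
    -- (E(m) ⊗ 1) · j(n) = G(m) · j(n); contraction along the L-coaction gives m ⊗ p, whose value on
    -- the R-coaction of m is that coaction itself.
    rw [← X.coassocLR.lift_eq ((mu.compl₁₂ (𝒞.proj h) 𝒞.j).compr₂ (BT.mk X.actR 𝓗.lR))
      (fun l m n p => by simp [𝒞.proj_actL h assoc, assoc, 𝒞.j_left])
      (fun m r n p => by
        have := h.actR (𝒞.proj h m) (op r) (𝒞.j n)
        rw [𝒜.actR_eq] at this
        simp only [LinearMap.compr₂_apply, LinearMap.compl₁₂_apply]
        rw [𝒞.j_actR, this, BT.mk_bal])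
      (BT.mk X.actR 𝓗.lR) (fun r m p => BT.mk_bal r m p) (fun m p => ?_)
      (h.diag.compl₁₂ G 𝒞.j) (bal G hG) (fun m n => ?_) m]
    · generalize X.coR m = z
      induction z using BT.induction with
      | hm m n => simp
      | h0 => simp
      | ha x y hx hy => simp only [map_add, ← hx, ← hy]
    · conv_lhs => rw [← 𝒞.proj_convolution h assoc one m]
      generalize X.coL m = z
      induction z using BT.induction with
      | hm m n =>
        refine Eq.trans ?_ (BT.lift_mk _ _ m n).symm
        simp
      | h0 => simp
      | ha x y hx hy => simp only [map_add, LinearMap.add_apply, hx, hy]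
    · simp only [LinearMap.compl₁₂_apply, G, LinearMap.comp_apply, LinearMap.flip_apply]
      rw [h.diag_mk_one, 𝒞.coR_j]
      generalize 𝓗.right.Δ n = z
      induction z using BT.induction with
      | hm m n => simp
      | h0 => simp
      | ha x y hx hy => simp only [map_add, hx, hy]
  -- Any such Φ is recovered as the convolution of the R-coaction with j', an expression that does
  -- not involve Φ.
  have inv := fun Φ hΦ (c : ∀ m, X.coR m = BT.lift (h.diag.compl₁₂ Φ 𝒞.j) (bal Φ hΦ) (X.coL m)) =>
    X.coassocLR.convolution_inverse X.isComoduleL.counit h.diag (h.diag_diag assoc) 𝒞.ηL Φ hΦ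
      𝒞.j 𝒞.j_left 𝒞.j' _ 𝒞.j_mul_j' X.coR (bal Φ hΦ) c bal' m
  exact (inv F hF cF).symm.trans (inv G hG cG)

/-- The projections onto the coinvariants are natural. -/
theorem proj_hom {X' : HComodule 𝓗 M'} {mu' : M' →ₗ[k] A →ₗ[k] M'} (h : X.IsAction 𝒜.com mu)
    (h' : X'.IsAction 𝒜.com mu') {i : M →ₗ[k] M'} (hi : X.IsHom X' i)
    (hmu : ∀ m a, mu' (i m) a = i (mu m a)) (m : M) : 𝒞.proj h' (i m) = i (𝒞.proj h m) := by
  rw [proj_apply, proj_apply, hi.coR]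
  generalize X.coR m = z
  induction z using BT.induction with
  | hm m n => simp [hmu]
  | h0 => simp
  | ha x y hx hy => simp only [map_add, hx, hy]

/-- Naturality of E for the A-linear colinear map a ↦ n a from A to M. -/
theorem proj_act_of_coinv (h : X.IsAction 𝒜.com mu)
    (assoc : ∀ m a b, mu (mu m a) b = mu m (a * b)) {n : M} (hn : X.coR n = BT.mk _ _ n 1)
    (a : A) : 𝒞.proj h (mu n a) = mu n (𝒞.proj 𝒜.isAction a) :=
  𝒞.proj_hom 𝒜.isAction h (h.isHom_of_coinv hn) (fun m a => by simp [assoc]) a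

theorem proj_mem (a : A) : 𝒞.proj 𝒜.isAction a ∈ 𝒜.coinvariants :=
  𝒞.coR_proj 𝒜.isAction (by simp [mul_assoc]) (by simp) a

/-- E need not fix coinvariants, as j is not assumed to be normalized; multiplying by j(1) corrects
this, because j'(1) j(1) = 1. -/
theorem proj_coinv (h : X.IsAction 𝒜.com mu) {n : M} (hn : X.coR n = BT.mk _ _ n 1) :
    𝒞.proj h n = mu n (𝒞.j' 1) := by
  rw [proj_apply, hn]
  simp

theorem j_one_mem : 𝒞.j 1 ∈ 𝒜.coinvariants := by
  change 𝒜.com.coR (𝒞.j 1) = _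
  rw [𝒞.coR_j, 𝓗.right.Δ_one, BT.map_mk]
  rfl

theorem j'_one_mul_j_one : 𝒞.j' 1 * 𝒞.j 1 = 1 := by
  have := 𝒞.j'_mul_j 1
  rw [𝓗.left.Δ_one, 𝓗.right.ε_one, BT.lift_mk] at this
  simpa using this

end ComoduleAlgebra.Cleaving

end Projection

end HopfAlgd

namespace HopfAlgd

theorem RAct.bil_bil {k B M : Type*} [CommRing k] [Ring B] [Algebra k B] [AddCommGroup M]
    [Module k M] (act : RAct k B M) (m : M) (a b : B) :
    act.bil (act.bil m a) b = act.bil m (a * b) := by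
  simp

theorem RAct.bil_one {k B M : Type*} [CommRing k] [Ring B] [Algebra k B] [AddCommGroup M]
    [Module k M] (act : RAct k B M) (m : M) : act.bil m 1 = m := by
  simp

section Equivalence

variable {k : Type u₁} [CommRing k] {L : Type u₂} [Ring L] [Algebra k L] {R : Type u₃} [Ring R]
  [Algebra k R] {H : Type u₄} [Ring H] [Algebra k H] {𝓗 : HopfAlgebroid k L R H}
  {A : Type u₅} [Ring A] [Algebra k A] {𝒜 : ComoduleAlgebra 𝓗 A}
  {M : Type*} [AddCommGroup M] [Module k M] {M' : Type*} [AddCommGroup M'] [Module k M']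

/-! ### Inverses of comodule maps and the submodule of coinvariants -/

namespace HComodule

/-- The inverse of a bijective comodule map is a comodule map. -/
theorem IsHom.symm {X : HComodule 𝓗 M} {X' : HComodule 𝓗 M'} (e : M ≃ₗ[k] M')
    (h : X.IsHom X' e.toLinearMap) : X'.IsHom X e.symm.toLinearMap := by
  have hR : ∀ (r : Rᵐᵒᵖ) m, e.symm (X'.actR r m) = X.actR r (e.symm m) := fun r m => by
    rw [e.symm_apply_eq]
    simpa using (h.actR r (e.symm m)).symm
  have hL : ∀ (l : Lᵐᵒᵖ) m, e.symm (X'.actL l m) = X.actL l (e.symm m) := fun l m => by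
    rw [e.symm_apply_eq]
    simpa using (h.actL l (e.symm m)).symm
  refine ⟨hR, hL, fun m => ?_, fun m => ?_⟩
  · obtain ⟨m, rfl⟩ := e.surjective m
    have := h.coR m
    simp only [LinearEquiv.coe_coe] at this ⊢
    rw [this, e.symm_apply_apply]
    generalize X.coR m = z
    induction z using BT.induction with
    | hm m n => simp
    | h0 => simp
    | ha x y hx hy => simp only [map_add, ← hx, ← hy]
  · obtain ⟨m, rfl⟩ := e.surjective m
    have := h.coL m
    simp only [LinearEquiv.coe_coe] at this ⊢
    rw [this, e.symm_apply_apply]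
    generalize X.coL m = z
    induction z using BT.induction with
    | hm m n => simp
    | h0 => simp
    | ha x y hx hy => simp only [map_add, ← hx, ← hy]

/-- The coinvariants of a comodule. -/
def coinv (X : HComodule 𝓗 M) : Submodule k M where
  carrier := {m | X.coR m = BT.mk _ _ m 1}
  add_mem' {a b} ha hb := by
    rw [Set.mem_ofPred_eq] at ha hb ⊢
    simp [ha, hb]
  zero_mem' := by simp
  smul_mem' c m hm := by
    rw [Set.mem_ofPred_eq] at hm ⊢
    simp [hm]

end HComodule

namespace ComoduleAlgebra

open HComodule

attribute [local instance] moduleCatModule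

/-! ### The retraction of A onto B and the coinvariants of W ⊗_B A -/

section Retraction

variable {B : Type*} [Ring B] [Algebra k B] {f : B →ₐ[k] A}

/-- A left `B`-linear retraction of `f : B → A`, if `f` is an isomorphism onto the coinvariants. -/
theorem Cleaving.exists_retraction (hf : ∀ b, f b ∈ 𝒜.coinvariants) (𝒞 : 𝒜.Cleaving)
    (hinj : Function.Injective f)
    (hsurj : ∀ a ∈ 𝒜.coinvariants, ∃ b, f b = a) :
    ∃ q : A →ₗ[k] B, (∀ a, f (q a) = 𝒞.proj 𝒜.isAction a * 𝒞.j 1) ∧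
      (∀ b a, q (f b * a) = b * q a) ∧ q 1 = 1 := by
  let e : B ≃ₐ[k] 𝒜.coinvariants := AlgEquiv.ofBijective (f.codRestrict 𝒜.coinvariants hf)
    ⟨fun x y h => hinj (congrArg Subtype.val h),
      fun a => (hsurj a a.2).imp fun b hb => Subtype.ext hb⟩
  -- The map a ↦ E(a) j(1). The factor j(1), itself coinvariant, makes it send 1 to j'(1) j(1) = 1.
  let p : A →ₗ[k] Subalgebra.toSubmodule 𝒜.coinvariants := LinearMap.codRestrict _
    (LinearMap.mulRight k (𝒞.j 1) ∘ₗ 𝒞.proj 𝒜.isAction)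
    (fun a => 𝒜.coinvariants.mul_mem (𝒞.proj_mem a) 𝒞.j_one_mem)
  have hq : ∀ a, f (e.symm (p a)) = 𝒞.proj 𝒜.isAction a * 𝒞.j 1 := fun a =>
    congrArg Subtype.val (e.apply_symm_apply (p a))
  refine ⟨e.symm.toLinearMap ∘ₗ p, hq, fun b a => hinj ?_, hinj ?_⟩
  · have := 𝒞.proj_act_of_coinv 𝒜.isAction (by simp [mul_assoc]) (hf b) a
    rw [LinearMap.mul_apply', LinearMap.mul_apply'] at this
    refine (hq _).trans ?_
    rw [this, map_mul f, mul_assoc]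
    exact congrArg _ (hq a).symm
  · refine (hq 1).trans ?_
    rw [𝒞.proj_coinv 𝒜.isAction 𝒜.coR_one, LinearMap.mul_apply', one_mul,
      𝒞.j'_one_mul_j_one, map_one]

variable (hf : ∀ b, f b ∈ 𝒜.coinvariants) {W : Type*} [AddCommGroup W] [Module k W]
  (ρ : RAct k B W)

theorem Cleaving.proj_mk (𝒞 : 𝒜.Cleaving) (w : W) (a : A) :
    𝒞.proj (𝒜.induced_isAction f hf ρ) (BT.mk _ _ w a) =
      BT.mk _ _ w (𝒞.proj 𝒜.isAction a) :=
  𝒞.proj_hom 𝒜.isAction (𝒜.induced_isAction f hf ρ) (𝒜.mk_isHom f hf ρ w)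
    (fun m a => inducedAct_mk f ρ w m a) a

/-- The map `w ⊗ a ↦ w q(a)`. -/
def retract (q : A →ₗ[k] B) (hq : ∀ b a, q (f b * a) = b * q a) : BT ρ (lmulL f) →ₗ[k] W :=
  BT.lift (ρ.bil.compl₂ q) (fun b w a => by simp [hq])

theorem retract_mk (q : A →ₗ[k] B) (hq : ∀ b a, q (f b * a) = b * q a) (w : W) (a : A) :
    retract ρ q hq (BT.mk _ _ w a) = ρ (op (q a)) w :=
  BT.lift_mk _ _ w a

/-- The coinvariants of `W ⊗_B A` are the elements `w ⊗ 1`. -/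
theorem Cleaving.mk_retract (𝒞 : 𝒜.Cleaving) (q : A →ₗ[k] B)
    (h : ∀ a, f (q a) = 𝒞.proj 𝒜.isAction a * 𝒞.j 1) (hq : ∀ b a, q (f b * a) = b * q a)
    {z : BT ρ (lmulL f)} (hz : 𝒜.indCoR f hf ρ z = BT.mk _ _ z 1) :
    BT.mk ρ (lmulL f) (retract ρ q hq z) 1 = z := by
  -- By naturality E(w ⊗ a) j(1) = w ⊗ E(a) j(1) = w q(a) ⊗ 1. For coinvariant z the left side is z
  -- j'(1) j(1) = z.
  have key : ∀ z, BT.mk ρ (lmulL f) (retract ρ q hq z) 1 =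
      (inducedAct f ρ).bil (𝒞.proj (𝒜.induced_isAction f hf ρ) z) (𝒞.j 1) := fun z => by
    induction z using BT.induction with
    | hm w a =>
      rw [retract_mk, 𝒞.proj_mk, RAct.bil_apply, inducedAct_mk, BT.mk_bal, ← h]
      simp
    | h0 => simp
    | ha x y hx hy => simp only [map_add, LinearMap.add_apply, hx, hy]
  rw [key, 𝒞.proj_coinv (𝒜.induced_isAction f hf ρ) hz, RAct.bil_bil, 𝒞.j'_one_mul_j_one,
    RAct.bil_one]

theorem inducedCoR_mk_one (w : W) :
    𝒜.indCoR f hf ρ (BT.mk _ _ w 1) = BT.mk _ _ (BT.mk _ _ w 1) 1 := by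
  rw [indCoR_mk, 𝒜.coR_one, BT.map_mk]
  rfl

theorem mk_act (w : W) (b : B) :
    BT.mk ρ (lmulL f) (ρ (op b) w) 1 = inducedAct f ρ (op (f b)) (BT.mk _ _ w 1) := by
  rw [inducedAct_mk, BT.mk_bal]
  simp

end Retraction

/-! ### The counit M^co ⊗_B A → M is bijective -/

section Counit

variable {B : Type*} [Ring B] [Algebra k B] (f : B →ₐ[k] A) (hf : ∀ b, f b ∈ 𝒜.coinvariants)
  (X : HopfModule.{v} 𝒜)

/-- The right `B`-module structure on the coinvariants of a Hopf module. -/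
@[reducible] def coinvModule : Module Bᵐᵒᵖ X.com.coinv where
  smul b n := ⟨X.act (op (f b.unop)) n, X.isAction.coinv_act n.2 (hf b.unop)⟩
  one_smul n := Subtype.ext (show X.act (op (f 1)) n = n by simp)
  mul_smul a b n := Subtype.ext (show X.act (op (f (b.unop * a.unop))) n =
    X.act (op (f a.unop)) (X.act (op (f b.unop)) n) by simp)
  smul_zero a := Subtype.ext (show X.act _ 0 = 0 by simp)
  zero_smul n := Subtype.ext (show X.act (op (f 0)) n = 0 by simp)
  smul_add a x y := Subtype.ext (show X.act (op (f a.unop)) (x.1 + y.1) = X.act _ x.1 + X.act _ y.1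
    by simp)
  add_smul a b n := Subtype.ext (show X.act (op (f (a.unop + b.unop))) n =
    X.act (op (f a.unop)) n + X.act (op (f b.unop)) n by simp)

/-- The right `B`-module of coinvariants of a Hopf module. -/
def coinvModuleCat : ModuleCat.{v} Bᵐᵒᵖ :=
  letI := coinvModule f hf X
  ModuleCat.of Bᵐᵒᵖ X.com.coinv

/-- The inclusion of the coinvariants into a Hopf module. -/
def coinvIncl : coinvModuleCat f hf X →ₗ[k] X.carrier where
  toFun := Subtype.val (p := (· ∈ X.com.coinv))
  map_add' _ _ := rfl
  -- The scalars of k on the source are restricted from Bᵐᵒᵖ rather than inherited from the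
  -- submodule; they agree because f and the action are k-algebra maps.
  map_smul' c n := by
    change X.act (op (f (algebraMap k B c))) _ = _
    rw [AlgHom.commutes, ← MulOpposite.algebraMap_apply, AlgHom.commutes]
    rfl

theorem coinvIncl_coR (n : coinvModuleCat f hf X) :
    X.com.coR (coinvIncl f hf X n) = BT.mk _ _ (coinvIncl f hf X n) 1 :=
  Subtype.property (p := (· ∈ X.com.coinv)) n

theorem coinvIncl_act (b : B) (n : coinvModuleCat f hf X) :
    coinvIncl f hf X (modAct (k := k) _ (op b) n) = X.act (op (f b)) (coinvIncl f hf X n) := (rfl)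

theorem coinvIncl_injective : Function.Injective (coinvIncl f hf X) :=
  Subtype.val_injective (p := (· ∈ X.com.coinv))

theorem exists_coinvIncl {m : X.carrier} (hm : X.com.coR m = BT.mk _ _ m 1) :
    ∃ n, coinvIncl f hf X n = m :=
  ⟨(⟨m, hm⟩ : X.com.coinv), rfl⟩

/-- The map `n ⊗ a ↦ n a` from the module induced by the coinvariants of `X` to `X`. -/
def counitMap : BT (modAct (k := k) (coinvModuleCat f hf X)) (lmulL f) →ₗ[k] X.carrier :=
  BT.lift (X.act.bil ∘ₗ coinvIncl f hf X) (fun b n a => by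
    simp only [LinearMap.comp_apply, coinvIncl_act, lmulL_apply]
    exact X.act.bil_bil _ _ _)

theorem counitMap_mk (n : coinvModuleCat f hf X) (a : A) :
    counitMap f hf X (BT.mk _ _ n a) = X.act.bil (coinvIncl f hf X n) a :=
  BT.lift_mk _ _ n a

theorem counitMap_act (a : Aᵐᵒᵖ) (z) :
    counitMap f hf X (inducedAct f (modAct (k := k) (coinvModuleCat f hf X)) a z) =
      X.act a (counitMap f hf X z) := by
  induction a with | _ a
  induction z using BT.induction with
  | hm n b =>
    rw [inducedAct_mk, counitMap_mk, counitMap_mk, ← RAct.bil_apply X.act, RAct.bil_bil]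
  | h0 => simp
  | ha x y hx hy => simp only [map_add, hx, hy]

theorem counitMap_isHom : (𝒜.inducedComodule f hf (modAct (coinvModuleCat f hf X))).IsHom X.com
    (counitMap f hf X) := by
  have h := fun n => 𝒜.mk_isHom f hf (modAct (k := k) (coinvModuleCat f hf X)) n
  have h' := fun n => X.isAction.isHom_of_coinv (coinvIncl_coR f hf X n)
  refine ⟨fun r z => ?_, fun l z => ?_, fun z => ?_, fun z => ?_⟩
  · induction z using BT.induction with
    | hm n a => rw [← (h n).actR, counitMap_mk, counitMap_mk, (h' n).actR]
    | h0 => simp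
    | ha x y hx hy => simp only [map_add, hx, hy]
  · induction z using BT.induction with
    | hm n a => rw [← (h n).actL, counitMap_mk, counitMap_mk, (h' n).actL]
    | h0 => simp
    | ha x y hx hy => simp only [map_add, hx, hy]
  · induction z using BT.induction with
    | hm n a =>
      rw [counitMap_mk, (h n).coR, (h' n).coR]
      generalize 𝒜.com.coR a = v
      induction v using BT.induction with
      | hm m n => simp [counitMap_mk]
      | h0 => simp
      | ha x y hx hy => simp only [map_add, hx, hy]
    | h0 => simp
    | ha x y hx hy => simp only [map_add, hx, hy]
  · induction z using BT.induction with
    | hm n a =>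
      rw [counitMap_mk, (h n).coL, (h' n).coL]
      generalize 𝒜.com.coL a = v
      induction v using BT.induction with
      | hm m n => simp [counitMap_mk]
      | h0 => simp
      | ha x y hx hy => simp only [map_add, hx, hy]
    | h0 => simp
    | ha x y hx hy => simp only [map_add, hx, hy]

/-- In m = E(m₀) j(m₁) every E(m₀) is coinvariant, so m is a sum of products of a coinvariant and an
element of A. -/
theorem Cleaving.counitMap_surjective (𝒞 : 𝒜.Cleaving) :
    Function.Surjective (counitMap f hf X) := by
  intro m
  rw [← LinearMap.mem_range, ← 𝒞.proj_convolution X.isAction X.act.bil_bil X.act.bil_one m]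
  generalize X.com.coL m = z
  induction z using BT.induction with
  | hm x h =>
    obtain ⟨n, hn⟩ := exists_coinvIncl f hf X
      (𝒞.coR_proj X.isAction X.act.bil_bil X.act.bil_one x)
    refine ⟨BT.mk _ _ n (𝒞.j h), ?_⟩
    rw [counitMap_mk, hn, BT.lift_mk]
    rfl
  | h0 => simp
  | ha x y hx hy =>
    rw [map_add]
    exact Submodule.add_mem _ hx hy

/-- A left inverse is x ↦ E(x₀) ⊗ j(x₁). Indeed z = E(z₀) j(z₁) holds in M^co ⊗_B A as well, and
there E(z) depends only on the image of z in M. -/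
theorem Cleaving.counitMap_injective (𝒞 : 𝒜.Cleaving)
    (hsurj : ∀ a ∈ 𝒜.coinvariants, ∃ b, f b = a) : Function.Injective (counitMap f hf X) := by
  let ρ := modAct (k := k) (coinvModuleCat f hf X)
  let h := 𝒜.induced_isAction f hf ρ
  have hψ := counitMap_isHom f hf X
  have hex := fun m => exists_coinvIncl f hf X
      (𝒞.coR_proj X.isAction X.act.bil_bil X.act.bil_one m)
  choose g hg using hex
  -- The map m ↦ E(m) ⊗ 1, with `g m` denoting E(m) as an element of the module of coinvariants.
  let i : X.carrier →ₗ[k] BT ρ (lmulL f) :=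
    { toFun := fun m => BT.mk _ _ (g m) 1
      map_add' := fun x y => by
        rw [show g (x + y) = g x + g y from coinvIncl_injective f hf X (by simp [hg])]
        simp
      map_smul' := fun c x => by
        rw [show g (c • x) = c • g x from coinvIncl_injective f hf X (by simp [hg])]
        simp }
  -- With E(a) = f(b), one has E(n a) ⊗ 1 = n b ⊗ 1 = n ⊗ E(a) = E(n ⊗ a).
  have hi : ∀ z, i (counitMap f hf X z) = 𝒞.proj h z := fun z => by
    induction z using BT.induction with
    | hm n a =>
      obtain ⟨b, hb⟩ := hsurj _ (𝒞.proj_mem a)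
      have : g (counitMap f hf X (BT.mk _ _ n a)) = ρ (op b) n := by
        apply coinvIncl_injective f hf X
        rw [hg, coinvIncl_act, hb, counitMap_mk, 𝒞.proj_act_of_coinv X.isAction X.act.bil_bil
          (coinvIncl_coR f hf X n)]
        rfl
      change BT.mk _ _ (g _) 1 = _
      rw [this, 𝒞.proj_mk, ← hb, BT.mk_bal]
      simp
    | h0 => simp
    | ha x y hx hy => simp only [map_add, hx, hy]
  have bal : ∀ l m x, (inducedAct f ρ).bil.compl₁₂ i 𝒞.j (X.com.actL (op l) m) x =
      (inducedAct f ρ).bil.compl₁₂ i 𝒞.j m (𝓗.lL l x) := fun l m x => by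
    -- By surjectivity the balancing condition on M is inherited from the one already known on M^co
    -- ⊗_B A.
    obtain ⟨z, rfl⟩ := 𝒞.counitMap_surjective f hf X m
    rw [← hψ.actL]
    simp only [LinearMap.compl₁₂_apply, hi]
    exact 𝒞.proj_balanced h (inducedAct f ρ).bil_bil l z x
  refine Function.LeftInverse.injective
    (g := fun m => BT.lift ((inducedAct f ρ).bil.compl₁₂ i 𝒞.j) bal (X.com.coL m)) fun z => ?_
  conv_rhs => rw [← 𝒞.proj_convolution h (inducedAct f ρ).bil_bil (inducedAct f ρ).bil_one z]
  simp only [hψ.coL]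
  generalize (𝒜.inducedComodule f hf ρ).coL z = w
  induction w using BT.induction with
  | hm m n =>
    refine (congrArg _ (BT.map_mk _ _ _ _ m n)).trans ?_
    rw [BT.lift_mk, LinearMap.compl₁₂_apply, hi]
    exact (BT.lift_mk _ (𝒞.proj_balanced h (inducedAct f ρ).bil_bil) m n).symm
  | h0 => simp
  | ha x y hx hy => simp only [map_add, hx, hy]

end Counit

/-! ### The equivalence for a general isomorphism onto the coinvariants -/

/-- If `A` is cleft and `f` is an isomorphism of `B` onto the coinvariants of `A`, then `- ⊗_B A` is
an equivalence of categories. -/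
theorem Cleaving.isEquivalence_inducedFunctor (𝒞 : 𝒜.Cleaving) {B : Type*} [Ring B] [Algebra k B]
    (f : B →ₐ[k] A) (hf : ∀ b, f b ∈ 𝒜.coinvariants) (hinj : Function.Injective f)
    (hsurj : ∀ a ∈ 𝒜.coinvariants, ∃ b, f b = a) :
    (𝒜.inducedFunctor.{v} f hf).IsEquivalence := by
  obtain ⟨q, hq, hql, hq1⟩ := 𝒞.exists_retraction hf hinj hsurj
  have hr : ∀ (W : ModuleCat.{max v u₅} Bᵐᵒᵖ) (w : W),
      retract (modAct (k := k) W) q hql (BT.mk _ _ w 1) = w := fun W w => by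
    rw [retract_mk, hq1, op_one, map_one, Module.End.one_apply]
  refine @Functor.IsEquivalence.mk _ _ _ _ _ ⟨fun {W W'} g g' h => ?_⟩ ⟨fun {W W'} φ => ?_⟩
    ⟨fun X => ?_⟩
  -- Faithful: the retraction recovers g(w) from g(w) ⊗ 1.
  · ext w
    have h1 : indMap (k := k) f g (BT.mk _ _ w 1) = indMap f g' (BT.mk _ _ w 1) :=
      congrArg (fun φ => HopfModule.Hom.map φ (BT.mk (modAct (k := k) W) (lmulL f) w 1)) h
    rw [indMap_mk, indMap_mk] at h1
    have h2 := congrArg (retract (modAct (k := k) W') q hql) h1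
    rwa [hr, hr] at h2
  · let F : BT (modAct (k := k) W) (lmulL f) →ₗ[k] BT (modAct (k := k) W') (lmulL f) := φ.map
    have hFact : ∀ a z, F (inducedAct f _ a z) = inducedAct f _ a (F z) := φ.map_act
    have hF : (𝒜.inducedComodule f hf (modAct W)).IsHom (𝒜.inducedComodule f hf (modAct W')) F :=
      φ.isHom
    -- Full: w ⊗ 1 is coinvariant, hence so is its image under the colinear map `F`, which therefore
    -- has the form w' ⊗ 1. The preimage of `F` is w ↦ w'.
    have hF1 : ∀ w, BT.mk _ _ (retract (modAct (k := k) W') q hql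
        (F (BT.mk _ _ w 1))) 1 =
        F (BT.mk _ _ w 1) := fun w => 𝒞.mk_retract hf _ q hq hql <| by
      refine (hF.coR _).trans ?_
      refine (congrArg _ (inducedCoR_mk_one hf (modAct (k := k) W) w)).trans ?_
      exact BT.map_mk _ _ _ _ _ _
    refine ⟨ModuleCat.ofHom
      { toFun := fun w => retract (modAct (k := k) W') q hql (F (BT.mk _ _ w 1))
        map_add' := fun x y => by simp
        map_smul' := fun b w => ?_ }, ?_⟩
    · induction b with | _ b
      have : BT.mk (modAct (k := k) W) (lmulL f) (op b • w) 1 = _ := mk_act (modAct (k := k) W) w b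
      rw [this, hFact, ← hF1, ← mk_act, hr, RingHom.id_apply, hr]
      rfl
    · refine HopfModule.Hom.ext (BT.hom_ext fun w a => ?_)
      refine (indMap_mk f _ w a).trans ?_
      have h1 : ∀ (W : ModuleCat.{max v u₅} Bᵐᵒᵖ) (w : W), BT.mk (modAct (k := k) W) (lmulL f) w a =
          inducedAct f _ (op a) (BT.mk _ _ w 1) := fun W w => by rw [inducedAct_mk, one_mul]
      change _ = F (BT.mk _ _ w a)
      rw [h1, h1, hFact, ← hF1]
      rfl
  -- Essentially surjective: X is isomorphic, via the counit, to the Hopf module induced from its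
  -- coinvariants.
  · let e := LinearEquiv.ofBijective (counitMap f hf X)
      ⟨𝒞.counitMap_injective f hf X hsurj, 𝒞.counitMap_surjective f hf X⟩
    refine ⟨coinvModuleCat f hf X, ⟨
      { hom := ⟨counitMap f hf X, counitMap_act f hf X, counitMap_isHom f hf X⟩
        inv := ⟨e.symm.toLinearMap, fun a m => ?_, (counitMap_isHom f hf X).symm e⟩
        hom_inv_id := HopfModule.hom_ext fun m => e.symm_apply_apply m
        inv_hom_id := HopfModule.hom_ext fun m => e.apply_symm_apply m }⟩⟩
    refine e.symm_apply_eq.2 (Eq.symm ?_)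
    refine (counitMap_act f hf X a (e.symm m)).trans ?_
    exact congrArg _ (e.apply_symm_apply m)

end ComoduleAlgebra

/-! ### The regular comodule algebra -/

namespace HopfAlgebroid

variable (𝓗)

/-- The cleaving of the regular comodule algebra given by the antipode. -/
def regularCleaving : 𝓗.regular.Cleaving where
  ηL := 𝓗.left.s
  ηL_mem := 𝓗.s_left_mem
  j := LinearMap.id
  j_left _ _ := rfl
  j_hom := .id _
  j' := 𝓗.S
  j'_left r h := by
    change _ = 𝓗.right.s r * _
    simpa using 𝓗.S_twist 1 r h
  j'_right l h := by simpa using 𝓗.S_twist l 1 h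
  j_mul_j' := 𝓗.antipode_right
  j'_mul_j := 𝓗.antipode_left

/-- The antipode axiom on a coinvariant a reads s_L(ε_L(a)) = a⁰ S(a¹) = a S(1) = a. -/
theorem exists_s_left_of_coinv {a : H} (ha : a ∈ 𝓗.regular.coinvariants) :
    ∃ l, 𝓗.left.s l = a := by
  refine ⟨𝓗.left.ε a, ?_⟩
  have ha' : 𝓗.right.Δ a = BT.mk _ _ a 1 := ha
  rw [← 𝓗.antipode_right, ha', BT.lift_mk]
  simp [𝓗.S_one]

end HopfAlgebroid

end Equivalence

end HopfAlgd

theorem mainTheorem6 {k : Type u₁} [CommRing k] {L : Type u₂} [Ring L] [Algebra k L]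
    {R : Type u₃} [Ring R] [Algebra k R] {H : Type u₄} [Ring H] [Algebra k H]
    (𝓗 : HopfAlgd.HopfAlgebroid k L R H) :
    (∀ {A : Type u₅} [Ring A] [Algebra k A] (𝒜 : HopfAlgd.ComoduleAlgebra 𝓗 A), 𝒜.IsCleft →
      (HopfAlgd.ComoduleAlgebra.tensorFunctor.{v} 𝒜).IsEquivalence) ∧
    (HopfAlgd.HopfAlgebroid.tensorFunctor.{v} 𝓗).IsEquivalence := by
  refine ⟨fun 𝒜 ⟨𝒞⟩ => ?_, ?_⟩
  · exact 𝒞.isEquivalence_inducedFunctor _ _ Subtype.val_injective fun a ha => ⟨⟨a, ha⟩, rfl⟩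
  -- Here f = s_L, which is injective because ε_L is a left inverse.
  · exact 𝓗.regularCleaving.isEquivalence_inducedFunctor _ _
      (Function.LeftInverse.injective 𝓗.ε_s_left) fun a ha => 𝓗.exists_s_left_of_coinv ha
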